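/- For each $n\ge 1$ let $p_n\in[0,1]$ and let $\xi^{(n)}_1,\dots,\xi^{(n)}_n$ be i.i.d. random variables with $P(\xi^{(n)}_i=1)=p_n=1-P(\xi^{(n)}_i=0)$. Let $U^{(n,p_n)}$ be the length of the longest arithmetic progression in $\Sigma_n=\{1\le i\le n:\xi^{(n)}_i=1\}$, that is, the largest $m\ge 1$ for which there are $1\le a,s\le n$ with $a+(m-1)s\le n$ and $a,a+s,\dots,a+(m-1)s\in\Sigma_n$. Let $W^{(n,p_n)}$ be the length of the longest arithmetic progression mod $n$, that is, the largest $m\ge1$ for which there are $1\le a,s\le n$ with $m\le n/\gcd(s,n)$ such that the residues mod $n$ of $a,a+s,\dots,a+(m-1)s$, taken in $\{1,\dots,n\}$, all lie in $\Sigma_n$. (Both are $0$ if $\Sigma_n=\emptyset$.) Write $[x]$ for the integer part of $x$. **Theorem 1.3.** Assume that $$\lim_{n\to\infty}p_n=0,\qquad \lim_{n\to\infty}np_n=\infty,\qquad \lim_{n\to\infty}\frac{2\ln n}{-\ln p_n}=b\in[2,\infty].$$ (i) If $b=\infty$, then, with $r_n=\left[\frac{2\ln n}{-\ln p_n}+\frac{\ln\ln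 n}{\ln p_n}\right]$ and $R_n=\left[\frac{2\ln n}{-\ln p_n}\right]$, $$\lim_{n\to\infty}P\big(U^{(n,p_n)}\in\{r_n,r_n+1\}\big)=1,\qquad \lim_{n\to\infty}P\big(W^{(n,p_n)}\in\{R_n-1,R_n,R_n+1\}\big)=1.$$ (ii) If $b=2$, or if $2<b<\infty$ and $b$ is not an integer, then $$\lim_{n\to\infty}P\big(W^{(n,p_n)}=[b]\big)=\lim_{n\to\infty}P\big(U^{(n,p_n)}=[b]\big)=1.$$ (iii) If $3\le b<\infty$ and $b$ is an integer, then $$\lim_{n\to\infty}P\big(W^{(n,p_n)}\in\{b-1,b\}\big)=\lim_{n\to\infty}P\big(U^{(n,p_n)}\in\{b-1,b\}\big)=1.$$ If in addition $u=\lim_{n\to\infty}n^2p_n^b\in[0,\infty]$ exists, then (with $e^{-\infty}=0$) $$\lim_{n\to\infty}P\big(U^{(n,p_n)}=b-1\big)=e^{-\frac{u}{2(b-1)}}=1-\lim_{n\to\infty}P\big(U^{(n,p_n)}=b\big)$$ and $$\lim_{n\to\infty}P\big(W^{(n,p_n)}=b-1\big)=e^{-\frac{u}{2}}=1-\lim_{n\to\infty}P\big(W^{(n,p_n)}=b\big).$$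 -/

import Mathlib

open Filter Topology MeasureTheory ProbabilityTheory

/-- For a `0-1` sequence `x 1, …, x n`, the largest `m` with `1 ≤ m ≤ 1 + ⌊(n - a) / s⌋` and
`x a = x (a + s) = ⋯ = x (a + (m - 1) s) = 1`; it is `0` if there is no such `m`
(that is, if `x a ≠ 1`). Used for `1 ≤ a, s ≤ n`. -/
def apLengthFrom (n : ℕ) (x : ℕ → ℕ) (a s : ℕ) : ℕ :=
  ((Finset.Icc 1 (1 + (n - a) / s)).filter (fun m => ∀ j < m, x (a + j * s) = 1)).sup id

/-- The length of the longest arithmetic progression in `{1 ≤ i ≤ n : x i = 1}`. -/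
def longestAP (n : ℕ) (x : ℕ → ℕ) : ℕ :=
  (Finset.Icc 1 n).sup fun a => (Finset.Icc 1 n).sup fun s => apLengthFrom n x a s

/-- The representative of `k` modulo `n` in `{1, …, n}` (so multiples of `n` are sent to `n`). -/
def modRep (n k : ℕ) : ℕ := if k % n = 0 then n else k % n

/-- For a `0-1` sequence `x 1, …, x n`, the largest `m` with `1 ≤ m ≤ n / gcd(s, n)` and
`x a = x (a + s mod n) = ⋯ = x (a + (m - 1) s mod n) = 1`; it is `0` if there is no such `m`.
Used for `1 ≤ a, s ≤ n`. -/
def modAPLengthFrom (n : ℕ) (x : ℕ → ℕ) (a s : ℕ) : ℕ :=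
  ((Finset.Icc 1 (n / Nat.gcd s n)).filter
    (fun m => ∀ j < m, x (modRep n (a + j * s)) = 1)).sup id

/-- The length of the longest arithmetic progression mod `n` in `{1 ≤ i ≤ n : x i = 1}`. -/
def longestModAP (n : ℕ) (x : ℕ → ℕ) : ℕ :=
  (Finset.Icc 1 n).sup fun a => (Finset.Icc 1 n).sup fun s => modAPLengthFrom n x a s

/-! Let X be the longest progression and N the number of possible supports of length m. For fixed m,
N is n²/(2(m-1)) up to O(n) in {1,…,n}. Mod n it is n²/2 up to O(n), because a progression and its
reverse have the same support. About N p^m progressions are expected, and n² p^m = exp(2 ln n -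
m(-ln p)) passes from large to small as m crosses 2 ln n / (-ln p).

Three estimates make this precise. The union bound `real_exists_allOccur_le` shows that X ≥ m is
unlikely when N p^m is small. The second moment bound `real_noneOccur_mul_sq_le` shows that X < m is
unlikely when N p^m is large. The local dependence bound `abs_real_noneOccur_sub_prod_le` compares
P(X < m) with (1 - p^m)^N, which tends to exp(-cu) when n² p^m → u and N ~ c n².

The last two need only the total weight of the progressions meeting a given one,
`GoodDifferences.sum_pow_card_union_le`. Those meeting it in one point are at most m² times the
number of differences; they are negligible because np → ∞. Those with another difference and at
least two common points number at most m^5 and share at most (m+1)/2 points. Shifts with the same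
difference give a geometric series. `GoodDifferences` collects what this uses, so one argument
serves both ℤ and `ZMod n`.

For finite b only fixed lengths matter (`ThresholdLaw`). For b = ∞ the length grows but stays below
2 ln n, so powers of m lose against powers of n. What remains is the main term: in {1,…,n} the
factor 1/m in N causes the ln ln n correction, while mod n there is no such factor. -/

/-! ### Moment and local dependence bounds for families of independent events. -/

section BernoulliEvents

variable {Ω G κ : Type*}

/-- The event that all `E i`, `i ∈ A`, occur. -/
def allOccur (E : G → Set Ω) (A : Finset G) : Set Ω := ⋂ i ∈ A, E i

/-- The event that none of the events `allOccur E (supp f)`, `f ∈ F`, occurs. -/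
def noneOccur (E : G → Set Ω) (supp : κ → Finset G) (F : Finset κ) : Set Ω :=
  ⋂ f ∈ F, (allOccur E (supp f))ᶜ

/-- The events `E i`, `i ∈ V`, are independent and each has probability `p`. -/
structure IsBernoulliFamily [MeasurableSpace Ω] (P : Measure Ω) (V : Finset G) (E : G → Set Ω)
    (p : ℝ) : Prop where
  measurableSet : ∀ i ∈ V, MeasurableSet (E i)
  real_allOccur : ∀ S ⊆ V, P.real (allOccur E S) = p ^ S.card

theorem mem_allOccur {E : G → Set Ω} {A : Finset G} {ω : Ω} :
    ω ∈ allOccur E A ↔ ∀ i ∈ A, ω ∈ E i := by simp [allOccur]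

theorem mem_noneOccur {E : G → Set Ω} {supp : κ → Finset G} {F : Finset κ} {ω : Ω} :
    ω ∈ noneOccur E supp F ↔ ∀ f ∈ F, ω ∉ allOccur E (supp f) := by simp [noneOccur]

theorem allOccur_union [DecidableEq G] (E : G → Set Ω) (A B : Finset G) :
    allOccur E (A ∪ B) = allOccur E A ∩ allOccur E B := by
  ext ω; simp only [mem_allOccur, Set.mem_inter_iff, Finset.mem_union]
  constructor
  · exact fun h => ⟨fun i hi => h i (.inl hi), fun i hi => h i (.inr hi)⟩
  · rintro ⟨h1, h2⟩ i (hi | hi)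
    exacts [h1 i hi, h2 i hi]

theorem noneOccur_insert [DecidableEq κ] (E : G → Set Ω) (supp : κ → Finset G) (F : Finset κ)
    (f : κ) : noneOccur E supp (insert f F) = (allOccur E (supp f))ᶜ ∩ noneOccur E supp F := by
  simp [noneOccur]

namespace IsBernoulliFamily

variable [MeasurableSpace Ω] {P : Measure Ω} {V : Finset G} {E : G → Set Ω} {p : ℝ}

theorem measurableSet_allOccur (h : IsBernoulliFamily P V E p) {A : Finset G} (hA : A ⊆ V) :
    MeasurableSet (allOccur E A) :=
  A.measurableSet_biInter fun i hi => h.measurableSet i (hA hi)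

theorem measurableSet_noneOccur (h : IsBernoulliFamily P V E p) {supp : κ → Finset G}
    {F : Finset κ} (hF : ∀ f ∈ F, supp f ⊆ V) : MeasurableSet (noneOccur E supp F) :=
  F.measurableSet_biInter fun f hf => (h.measurableSet_allOccur (hF f hf)).compl

theorem real_allOccur_inter [DecidableEq G] (h : IsBernoulliFamily P V E p) {A B : Finset G} (hA : A ⊆ V)
    (hB : B ⊆ V) : P.real (allOccur E A ∩ allOccur E B) = p ^ (A ∪ B).card := by
  rw [← allOccur_union, h.real_allOccur _ (Finset.union_subset hA hB)]

/-- Union bound. -/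
theorem real_exists_allOccur_le (h : IsBernoulliFamily P V E p) {supp : κ → Finset G}
    (F : Finset κ) (hF : ∀ f ∈ F, supp f ⊆ V) :
    P.real {ω | ∃ f ∈ F, ω ∈ allOccur E (supp f)} ≤ ∑ f ∈ F, p ^ (supp f).card := by
  have e : {ω | ∃ f ∈ F, ω ∈ allOccur E (supp f)} = ⋃ f ∈ F, allOccur E (supp f) := by
    ext; simp
  rw [e]
  exact (measureReal_biUnion_finset_le _ _).trans
    (Finset.sum_le_sum fun f hf => (h.real_allOccur _ (hF f hf)).le)

variable [IsProbabilityMeasure P] [DecidableEq G]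

/-- Independence of events on disjoint index sets, derived from the product formula alone. The
auxiliary set `D` makes the induction on `J` close: splitting along the event of `j` yields one
instance with `D` and one with `D ∪ supp j`. -/
theorem real_inter_noneOccur_aux (h : IsBernoulliFamily P V E p) {supp : κ → Finset G}
    (J : Finset κ) (A : Finset G) (hA : A ⊆ V)
    (hJ : ∀ j ∈ J, supp j ⊆ V ∧ Disjoint A (supp j)) :
    ∀ D ⊆ V, Disjoint A D →
    P.real (allOccur E A ∩ (allOccur E D ∩ noneOccur E supp J)) =
      p ^ A.card * P.real (allOccur E D ∩ noneOccur E supp J) := by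
  classical
  induction J using Finset.induction_on with
  | empty =>
    intro D hD hAD
    simp only [noneOccur, Finset.notMem_empty, Set.iInter_of_empty, Set.iInter_univ,
      Set.inter_univ]
    rw [← allOccur_union, h.real_allOccur _ (Finset.union_subset hA hD), h.real_allOccur _ hD,
      Finset.card_union_of_disjoint hAD, pow_add]
  | insert j J hj ih =>
    intro D hD hAD
    have hJ' : ∀ j ∈ J, supp j ⊆ V ∧ Disjoint A (supp j) :=
      fun i hi => hJ i (Finset.mem_insert_of_mem hi)
    obtain ⟨hjV, hjA⟩ := hJ j (Finset.mem_insert_self _ _)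
    have hm := h.measurableSet_allOccur hjV
    have e1 := ih hJ' D hD hAD
    have e2 := ih hJ' (D ∪ supp j) (Finset.union_subset hD hjV)
      (Finset.disjoint_union_right.2 ⟨hAD, hjA⟩)
    rw [allOccur_union] at e2
    have s1 := measureReal_inter_add_sdiff (μ := P)
      (s := allOccur E A ∩ (allOccur E D ∩ noneOccur E supp J)) hm
    have s2 := measureReal_inter_add_sdiff (μ := P)
      (s := allOccur E D ∩ noneOccur E supp J) hm
    rw [noneOccur_insert]
    rw [show allOccur E A ∩ (allOccur E D ∩ ((allOccur E (supp j))ᶜ ∩ noneOccur E supp J)) =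
      (allOccur E A ∩ (allOccur E D ∩ noneOccur E supp J)) \ allOccur E (supp j) by
        ext ω; simp only [Set.mem_inter_iff, Set.mem_compl_iff, Set.mem_sdiff]; tauto,
      show (allOccur E D ∩ ((allOccur E (supp j))ᶜ ∩ noneOccur E supp J)) =
      (allOccur E D ∩ noneOccur E supp J) \ allOccur E (supp j) by
        ext ω; simp only [Set.mem_inter_iff, Set.mem_compl_iff, Set.mem_sdiff]; tauto]
    rw [show allOccur E A ∩ (allOccur E D ∩ noneOccur E supp J) ∩ allOccur E (supp j) =
      allOccur E A ∩ (allOccur E D ∩ allOccur E (supp j) ∩ noneOccur E supp J) by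
        ext ω; simp only [Set.mem_inter_iff]; tauto] at s1
    rw [show allOccur E D ∩ noneOccur E supp J ∩ allOccur E (supp j) =
      allOccur E D ∩ allOccur E (supp j) ∩ noneOccur E supp J by
        ext ω; simp only [Set.mem_inter_iff]; tauto] at s2
    rw [e1, e2] at s1
    rw [← s2] at s1
    linear_combination s1

theorem real_inter_noneOccur (h : IsBernoulliFamily P V E p) {supp : κ → Finset G}
    (J : Finset κ) (A : Finset G) (hA : A ⊆ V)
    (hJ : ∀ j ∈ J, supp j ⊆ V ∧ Disjoint A (supp j)) :
    P.real (allOccur E A ∩ noneOccur E supp J) =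
      p ^ A.card * P.real (noneOccur E supp J) := by
  simpa [allOccur] using h.real_inter_noneOccur_aux J A hA hJ ∅ (by simp) (by simp)

/-- Local dependence bound for the probability that none of the events `allOccur E (supp g)`
occurs, given that `allOccur E A` occurs. -/
theorem abs_real_inter_noneOccur_sub_le (h : IsBernoulliFamily P V E p) (hp : 0 ≤ p)
    {supp : κ → Finset G} (F : Finset κ) (hF : ∀ f ∈ F, supp f ⊆ V) {A : Finset G} (hA : A ⊆ V) :
    |P.real (allOccur E A ∩ noneOccur E supp F) - p ^ A.card * P.real (noneOccur E supp F)| ≤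
      ∑ g ∈ F with ¬ Disjoint A (supp g),
        (p ^ (A ∪ supp g).card + p ^ (A.card + (supp g).card)) := by
  -- The members of `F₁` are exactly independent of `A`. Passing between `F` and `F₁` costs a union
  -- bound over `F₂`, once inside `allOccur E A` and once outside.
  set F₁ := F.filter fun g => Disjoint A (supp g) with hF₁
  set F₂ := F.filter fun g => ¬ Disjoint A (supp g) with hF₂
  have hsub : noneOccur E supp F ⊆ noneOccur E supp F₁ := fun ω hω =>
    mem_noneOccur.2 fun f hf => mem_noneOccur.1 hω f (Finset.mem_filter.1 hf).1
  have hcov : noneOccur E supp F₁ ⊆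
      noneOccur E supp F ∪ ⋃ g ∈ F₂, allOccur E (supp g) := by
    intro ω hω
    by_cases hc : ∃ g ∈ F₂, ω ∈ allOccur E (supp g)
    · right; simpa using hc
    · left
      push Not at hc
      refine mem_noneOccur.2 fun f hf => ?_
      by_cases hd : Disjoint A (supp f)
      · exact mem_noneOccur.1 hω f (Finset.mem_filter.2 ⟨hf, hd⟩)
      · exact hc f (Finset.mem_filter.2 ⟨hf, hd⟩)
  have key := h.real_inter_noneOccur F₁ A hA fun j hj =>
    ⟨hF j (Finset.mem_filter.1 hj).1, (Finset.mem_filter.1 hj).2⟩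
  have u1 : P.real (allOccur E A ∩ noneOccur E supp F) ≤
      P.real (allOccur E A ∩ noneOccur E supp F₁) :=
    measureReal_mono (Set.inter_subset_inter_right _ hsub)
  have u2 : P.real (noneOccur E supp F) ≤ P.real (noneOccur E supp F₁) := measureReal_mono hsub
  have l1 : P.real (allOccur E A ∩ noneOccur E supp F₁) ≤
      P.real (allOccur E A ∩ noneOccur E supp F) + ∑ g ∈ F₂, p ^ (A ∪ supp g).card := by
    calc _ ≤ P.real ((allOccur E A ∩ noneOccur E supp F) ∪
          ⋃ g ∈ F₂, (allOccur E A ∩ allOccur E (supp g))) := by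
          apply measureReal_mono _ (by finiteness)
          rw [← Set.inter_iUnion₂, ← Set.inter_union_distrib_left]
          exact Set.inter_subset_inter_right _ hcov
      _ ≤ _ := by
          refine (measureReal_union_le _ _).trans (add_le_add_right ?_ _)
          refine (measureReal_biUnion_finset_le _ _).trans (Finset.sum_le_sum fun g hg => ?_)
          exact (h.real_allOccur_inter hA (hF g (Finset.mem_filter.1 hg).1)).le
  have l2 : P.real (noneOccur E supp F₁) ≤
      P.real (noneOccur E supp F) + ∑ g ∈ F₂, p ^ (supp g).card := by
    refine (measureReal_mono hcov (by finiteness)).trans ?_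
    refine (measureReal_union_le _ _).trans (add_le_add_right ?_ _)
    refine (measureReal_biUnion_finset_le _ _).trans (Finset.sum_le_sum fun g hg => ?_)
    exact (h.real_allOccur _ (hF g (Finset.mem_filter.1 hg).1)).le
  have l3 := mul_le_mul_of_nonneg_left l2 (pow_nonneg hp A.card)
  have u3 := mul_le_mul_of_nonneg_left u2 (pow_nonneg hp A.card)
  rw [mul_add, Finset.mul_sum] at l3
  simp only [← pow_add] at l3
  have n1 : 0 ≤ ∑ g ∈ F₂, p ^ (A ∪ supp g).card :=
    Finset.sum_nonneg fun _ _ => pow_nonneg hp _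
  have n2 : 0 ≤ ∑ g ∈ F₂, p ^ (A.card + (supp g).card) :=
    Finset.sum_nonneg fun _ _ => pow_nonneg hp _
  rw [Finset.sum_add_distrib, abs_le]
  constructor <;> linarith

/-- Poisson-type approximation of the probability that none of the events occurs. -/
theorem abs_real_noneOccur_sub_prod_le [DecidableEq κ] (h : IsBernoulliFamily P V E p)
    (hp : 0 ≤ p) (hp1 : p ≤ 1)
    {supp : κ → Finset G} (F : Finset κ) (hF : ∀ f ∈ F, supp f ⊆ V) :
    |P.real (noneOccur E supp F) - ∏ f ∈ F, (1 - p ^ (supp f).card)| ≤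
      ∑ f ∈ F, ∑ g ∈ F with g ≠ f ∧ ¬ Disjoint (supp f) (supp g),
        (p ^ (supp f ∪ supp g).card + p ^ ((supp f).card + (supp g).card)) := by
  induction F using Finset.induction_on with
  | empty => simp [noneOccur]
  | insert f F hf ih =>
    have ih := ih fun g hg => hF g (Finset.mem_insert_of_mem hg)
    have hfV := hF f (Finset.mem_insert_self _ _)
    have key := h.abs_real_inter_noneOccur_sub_le hp F
      (fun g hg => hF g (Finset.mem_insert_of_mem hg)) hfV
    have s := measureReal_inter_add_sdiff (μ := P) (s := noneOccur E supp F)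
      (h.measurableSet_allOccur hfV)
    rw [Finset.prod_insert hf, Finset.sum_insert hf, noneOccur_insert,
      show (allOccur E (supp f))ᶜ ∩ noneOccur E supp F =
        noneOccur E supp F \ allOccur E (supp f) by rw [Set.inter_comm]; rfl]
    rw [Set.inter_comm] at s
    have nn : ∀ f g, 0 ≤ p ^ (supp f ∪ supp g).card + p ^ ((supp f).card + (supp g).card) :=
      fun f g => add_nonneg (pow_nonneg hp _) (pow_nonneg hp _)
    have m1 : ∑ g ∈ F with ¬ Disjoint (supp f) (supp g),
        (p ^ (supp f ∪ supp g).card + p ^ ((supp f).card + (supp g).card)) ≤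
        ∑ g ∈ insert f F with g ≠ f ∧ ¬ Disjoint (supp f) (supp g),
        (p ^ (supp f ∪ supp g).card + p ^ ((supp f).card + (supp g).card)) := by
      refine Finset.sum_le_sum_of_subset_of_nonneg (fun g hg => ?_) fun g _ _ => nn f g
      rw [Finset.mem_filter] at hg ⊢
      exact ⟨Finset.mem_insert_of_mem hg.1, fun e => hf (e ▸ hg.1), hg.2⟩
    have m2 : ∑ f' ∈ F, ∑ g ∈ F with g ≠ f' ∧ ¬ Disjoint (supp f') (supp g),
        (p ^ (supp f' ∪ supp g).card + p ^ ((supp f').card + (supp g).card)) ≤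
        ∑ f' ∈ F, ∑ g ∈ insert f F with g ≠ f' ∧ ¬ Disjoint (supp f') (supp g),
        (p ^ (supp f' ∪ supp g).card + p ^ ((supp f').card + (supp g).card)) := by
      refine Finset.sum_le_sum fun f' _ =>
        Finset.sum_le_sum_of_subset_of_nonneg (fun g hg => ?_) fun g _ _ => nn f' g
      rw [Finset.mem_filter] at hg ⊢
      exact ⟨Finset.mem_insert_of_mem hg.1, hg.2⟩
    refine le_trans ?_ (add_le_add (key.trans m1) (ih.trans m2))
    have q0 : 0 ≤ p ^ (supp f).card := pow_nonneg hp _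
    have q1 : p ^ (supp f).card ≤ 1 := pow_le_one₀ hp hp1
    -- The new error is the correlation error of `f` plus the old error times a factor in [0, 1], so
    -- the errors simply add up along the induction.
    have e : P.real (noneOccur E supp F \ allOccur E (supp f)) -
        (1 - p ^ (supp f).card) * ∏ g ∈ F, (1 - p ^ (supp g).card) =
        -(P.real (allOccur E (supp f) ∩ noneOccur E supp F) -
          p ^ (supp f).card * P.real (noneOccur E supp F)) +
        (1 - p ^ (supp f).card) * (P.real (noneOccur E supp F) -
          ∏ g ∈ F, (1 - p ^ (supp g).card)) := by
      linear_combination s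
    rw [e]
    refine (abs_add_le _ _).trans ?_
    rw [abs_neg, abs_mul, abs_of_nonneg (by linarith : 0 ≤ 1 - p ^ (supp f).card)]
    refine add_le_add_right ?_ _
    exact mul_le_of_le_one_left (abs_nonneg _) (by linarith)

/-- Second moment bound for the probability that none of the events occurs. -/
theorem real_noneOccur_mul_sq_le (h : IsBernoulliFamily P V E p) (hp : 0 ≤ p)
    {supp : κ → Finset G} (F : Finset κ) (hF : ∀ f ∈ F, supp f ⊆ V) :
    P.real (noneOccur E supp F) * (∑ f ∈ F, p ^ (supp f).card) ^ 2 ≤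
      ∑ f ∈ F, ∑ g ∈ F with ¬ Disjoint (supp f) (supp g), p ^ (supp f ∪ supp g).card := by
  set lam := ∑ f ∈ F, p ^ (supp f).card with hlam
  let B : κ → Set Ω := fun f => allOccur E (supp f)
  let I : Set Ω → Ω → ℝ := fun s => s.indicator 1
  have hB : ∀ f ∈ F, MeasurableSet (B f) := fun f hf => h.measurableSet_allOccur (hF f hf)
  have hN := h.measurableSet_noneOccur hF
  have hI : ∀ s, MeasurableSet s → Integrable (I s) P := fun s hs =>
    (integrable_const (1 : ℝ)).indicator hs
  have hEI : ∀ s, MeasurableSet s → ∫ ω, I s ω ∂P = P.real s := fun s hs =>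
    integral_indicator_one hs
  -- Chebyshev in pointwise form: λ² 1{N = 0} ≤ (N - λ)², where N counts the events that occur.
  have pt : ∀ ω, lam ^ 2 * I (noneOccur E supp F) ω ≤
      (∑ f ∈ F, ∑ g ∈ F, I (B f ∩ B g) ω) - 2 * lam * (∑ f ∈ F, I (B f) ω) + lam ^ 2 := by
    intro ω
    have e : ∑ f ∈ F, ∑ g ∈ F, I (B f ∩ B g) ω = (∑ f ∈ F, I (B f) ω) ^ 2 := by
      rw [sq, Finset.sum_mul_sum]
      refine Finset.sum_congr rfl fun f _ => Finset.sum_congr rfl fun g _ => ?_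
      simp only [I, Set.inter_indicator_one, Pi.mul_apply]
    rw [e]
    by_cases hω : ω ∈ noneOccur E supp F
    · have z : ∑ f ∈ F, I (B f) ω = 0 := Finset.sum_eq_zero fun f hf =>
        Set.indicator_of_notMem (mem_noneOccur.1 hω f hf) _
      rw [z]
      simp [I, hω]
    · have z : I (noneOccur E supp F) ω = 0 := Set.indicator_of_notMem hω _
      rw [z]
      nlinarith [sq_nonneg (∑ f ∈ F, I (B f) ω - lam)]
  have i1 : Integrable (fun ω => ∑ f ∈ F, ∑ g ∈ F, I (B f ∩ B g) ω) P :=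
    integrable_finsetSum _ fun f hf => integrable_finsetSum _ fun g hg =>
      hI _ ((hB f hf).inter (hB g hg))
  have i2 : Integrable (fun ω => ∑ f ∈ F, I (B f) ω) P :=
    integrable_finsetSum _ fun f hf => hI _ (hB f hf)
  have i3 : Integrable (fun ω => (∑ f ∈ F, ∑ g ∈ F, I (B f ∩ B g) ω) -
      2 * lam * ∑ f ∈ F, I (B f) ω) P := i1.sub (i2.const_mul (2 * lam))
  have int := integral_mono (μ := P) ((hI _ hN).const_mul (lam ^ 2))
    (i3.add (integrable_const (lam ^ 2))) pt
  simp only [Pi.add_apply] at int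
  rw [integral_const_mul, hEI _ hN, integral_add i3 (integrable_const (lam ^ 2)),
    integral_sub i1 (i2.const_mul (2 * lam)), integral_const_mul,
    integral_finsetSum _ (fun f hf => hI _ (hB f hf)),
    integral_finsetSum _ (fun f hf => integrable_finsetSum _ fun g hg =>
      hI _ ((hB f hf).inter (hB g hg)))] at int
  have c1 : ∑ f ∈ F, ∫ ω, I (B f) ω ∂P = lam :=
    Finset.sum_congr rfl fun f hf => by rw [hEI _ (hB f hf), h.real_allOccur _ (hF f hf)]
  -- Disjoint pairs are independent and contribute at most λ² in total, which cancels against -2λ² +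
  -- λ².
  have c2 : ∑ f ∈ F, ∫ ω, ∑ g ∈ F, I (B f ∩ B g) ω ∂P ≤
      (∑ f ∈ F, ∑ g ∈ F with ¬ Disjoint (supp f) (supp g), p ^ (supp f ∪ supp g).card) +
        lam ^ 2 := by
    rw [sq, hlam, Finset.sum_mul_sum, ← Finset.sum_add_distrib]
    refine Finset.sum_le_sum fun f hf => ?_
    rw [integral_finsetSum _ (fun g hg => hI _ ((hB f hf).inter (hB g hg))), Finset.sum_filter,
      ← Finset.sum_add_distrib]
    refine Finset.sum_le_sum fun g hg => ?_
    rw [hEI _ ((hB f hf).inter (hB g hg)), h.real_allOccur_inter (hF f hf) (hF g hg)]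
    split_ifs with hd
    · rw [Finset.card_union_of_disjoint hd, pow_add, zero_add]
    · exact le_add_of_nonneg_right (mul_nonneg (pow_nonneg hp _) (pow_nonneg hp _))
  rw [c1] at int
  simp only [integral_const, probReal_univ, one_smul] at int
  nlinarith

end IsBernoulliFamily

end BernoulliEvents

theorem sum_biUnion_le {α β : Type*} [DecidableEq α] [DecidableEq β] (s : Finset β)
    (t : β → Finset α) {w : α → ℝ} (hw : ∀ a, 0 ≤ w a) :
    ∑ a ∈ s.biUnion t, w a ≤ ∑ b ∈ s, ∑ a ∈ t b, w a := by
  induction s using Finset.induction_on with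
  | empty => simp
  | insert b s hb ih =>
    rw [Finset.biUnion_insert, Finset.sum_insert hb]
    have h1 := Finset.sum_union_inter (s₁ := t b) (s₂ := s.biUnion t) (f := w)
    have h2 : 0 ≤ ∑ a ∈ t b ∩ s.biUnion t, w a := Finset.sum_nonneg fun a _ => hw a
    linarith

/-! ### Intersections of progressions in an abelian group. -/

section Progressions

variable {G : Type*} [AddCommGroup G] [DecidableEq G]

/-- The arithmetic progression `a, a + s, …, a + (m - 1) s`. -/
def progression (m : ℕ) (f : G × G) : Finset G := (Finset.range m).image fun i => f.1 + i • f.2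

/-- Differences whose small multiples do not vanish, containing at most one of `s`, `-s`,
and at most `m` solutions of each equation `d • t = x` with `1 ≤ d < m`. -/
structure GoodDifferences (S : Finset G) (m : ℕ) : Prop where
  nsmul_ne_zero : ∀ s ∈ S, ∀ j : ℕ, 1 ≤ j → j ≤ m ^ 2 → j • s ≠ 0
  neg_notMem : ∀ s ∈ S, -s ∉ S
  card_nsmul_eq_le : ∀ (d : ℕ) (x : G), 1 ≤ d → d < m → {t ∈ S | d • t = x}.card ≤ m

theorem mem_progression {m : ℕ} {f : G × G} {x : G} :
    x ∈ progression m f ↔ ∃ i < m, f.1 + i • f.2 = x := by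
  simp [progression]

namespace GoodDifferences

variable {S : Finset G} {m : ℕ}

theorem zsmul_ne_zero (hS : GoodDifferences S m) {s : G} (hs : s ∈ S) {c : ℤ} (hc : c ≠ 0)
    (hcm : |c| ≤ (m : ℤ) ^ 2) : c • s ≠ 0 := by
  have h := hS.nsmul_ne_zero s hs c.natAbs (by omega) (by zify; exact hcm)
  intro h0
  apply h
  rcases Int.natAbs_eq c with e | e
  · rw [← natCast_zsmul, ← e, h0]
  · rw [← natCast_zsmul, show (c.natAbs : ℤ) = -c by omega, neg_zsmul, h0, neg_zero]

theorem zsmul_inj (hS : GoodDifferences S m) {s : G} (hs : s ∈ S) {c d : ℤ}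
    (hcm : |c - d| ≤ (m : ℤ) ^ 2) (h : c • s = d • s) : c = d := by
  by_contra hne
  refine hS.zsmul_ne_zero hs (sub_ne_zero.2 hne) hcm ?_
  rw [sub_zsmul, h]; abel

/-- Lengths beyond `m` are allowed because two overlapping shifts merge into a longer progression,
see `le_card_union`. -/
theorem card_progression (hS : GoodDifferences S m) {f : G × G} (hs : f.2 ∈ S) {k : ℕ}
    (hk : k ≤ m ^ 2 + 1) : (progression k f).card = k := by
  rw [progression, Finset.card_image_of_injOn, Finset.card_range]
  intro i hi j hj hij
  simp only [Finset.coe_range, Set.mem_Iio] at hi hj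
  have h1 : (i : ℤ) • f.2 = (j : ℤ) • f.2 := by simpa using hij
  have := hS.zsmul_inj hs (c := i) (d := j) (by rw [abs_le]; zify at *; constructor <;> linarith) h1
  exact_mod_cast this

/-- With that many common points, two of them have consecutive indices in `g`. Then `g.2` is a
difference of two points of `progression m f`. -/
theorem exists_eq_zsmul {f g : G × G}
    (h : (m + 1) / 2 < (progression m f ∩ progression m g).card) :
    ∃ c : ℤ, |c| < m ∧ g.2 = c • f.2 := by
  set L := (Finset.range m).filter fun l : ℕ => g.1 + l • g.2 ∈ progression m f with hL
  have hsub : progression m f ∩ progression m g ⊆ L.image fun l : ℕ => g.1 + l • g.2 := by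
    intro x hx
    obtain ⟨h1, h2⟩ := Finset.mem_inter.1 hx
    obtain ⟨l, hl, rfl⟩ := mem_progression.1 h2
    exact Finset.mem_image.2 ⟨l, by simp [hL, hl, h1], rfl⟩
  have hc : (Finset.range ((m + 1) / 2)).card < L.card := by
    rw [Finset.card_range]
    exact h.trans_le ((Finset.card_le_card hsub).trans Finset.card_image_le)
  -- Pigeonhole on the blocks {2i, 2i + 1}, of which (m+1)/2 cover the indices below `m`.
  obtain ⟨l, hl, l', hl', hne, heq⟩ := Finset.exists_ne_map_eq_of_card_lt_of_maps_to hc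
    (f := fun l => l / 2) (by
      intro l hl
      simp only [hL, Finset.coe_filter, Set.mem_ofPred_eq, Finset.mem_range] at hl
      simp only [Finset.coe_range, Set.mem_Iio]
      omega)
  have main : ∀ l ∈ L, l + 1 ∈ L → ∃ c : ℤ, |c| < m ∧ g.2 = c • f.2 := by
    intro l hl hl'
    obtain ⟨i, hi, e⟩ := mem_progression.1 (Finset.mem_filter.1 hl).2
    obtain ⟨i', hi', e'⟩ := mem_progression.1 (Finset.mem_filter.1 hl').2
    refine ⟨i' - i, by rw [abs_lt]; omega, ?_⟩
    rw [sub_zsmul, natCast_zsmul, natCast_zsmul]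
    rw [succ_nsmul, ← add_assoc, ← e] at e'
    rw [add_assoc] at e'
    rw [add_left_cancel e']; abel
  have heq' : l / 2 = l' / 2 := heq
  rcases lt_or_gt_of_ne hne with hlt | hlt
  · obtain rfl : l' = l + 1 := by omega
    exact main l hl hl'
  · obtain rfl : l = l' + 1 := by omega
    exact main l' hl' hl

/-- Otherwise each difference is a multiple of the other, by c and d with |c|, |d| < m. Then (dc -
1) • f.2 = 0 with |dc - 1| ≤ m², so dc = 1 and g.2 = ±f.2. This dictates the range `m ^ 2` and the
exclusion of opposite differences in `GoodDifferences`. -/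
theorem card_inter_le (hS : GoodDifferences S m) {f g : G × G} (hf : f.2 ∈ S) (hg : g.2 ∈ S)
    (hfg : g.2 ≠ f.2) : (progression m f ∩ progression m g).card ≤ (m + 1) / 2 := by
  by_contra! h
  obtain ⟨c, hc, e⟩ := exists_eq_zsmul h
  rw [Finset.inter_comm] at h
  obtain ⟨d, hd, e'⟩ := exists_eq_zsmul h
  have hb : |d * c - 1| ≤ (m : ℤ) ^ 2 := by
    have h1 : |d * c| ≤ ((m : ℤ) - 1) * (m - 1) := by
      rw [abs_mul]
      exact mul_le_mul (by linarith) (by linarith) (abs_nonneg _)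
        (by have := abs_nonneg d; linarith)
    have h2 := abs_sub (d * c) 1
    rw [abs_one] at h2
    have h3 : (1 : ℤ) ≤ m := by have := abs_nonneg d; linarith
    nlinarith
  have h1 : (d * c) • f.2 = (1 : ℤ) • f.2 := by
    rw [mul_zsmul, ← e, ← e', one_zsmul]
  have hdc := hS.zsmul_inj hf hb h1
  rw [mul_comm] at hdc
  rcases Int.eq_one_or_neg_one_of_mul_eq_one hdc with rfl | rfl
  · exact hfg (by rw [e, one_zsmul])
  · rw [neg_zsmul, one_zsmul] at e
    exact hS.neg_notMem _ hf (e ▸ hg)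

theorem le_card_union (hS : GoodDifferences S m) {a s : G} (hs : s ∈ S) {e : ℕ} (he : e < m) :
    m + e ≤ (progression m (a, s) ∪ progression m (a + e • s, s)).card := by
  have hk : m + e ≤ m ^ 2 + 1 := by
    obtain ⟨k, rfl⟩ : ∃ k, m = k + 1 := ⟨m - 1, by omega⟩
    nlinarith
  rw [← hS.card_progression (f := (a, s)) hs hk]
  refine Finset.card_le_card fun x hx => ?_
  obtain ⟨i, hi, rfl⟩ := mem_progression.1 hx
  rw [Finset.mem_union, mem_progression, mem_progression]
  by_cases him : i < m
  · exact .inl ⟨i, him, rfl⟩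
  · refine .inr ⟨i - e, by omega, ?_⟩
    simp only
    rw [add_assoc, ← add_nsmul, show e + (i - e) = i by omega]

/-- Such a `g` is a shift of `f` by ±e steps with 1 ≤ e < m, and the union has at least m + e
points. The two signs give one factor 2, the geometric series with p ≤ 1/2 the other. -/
theorem sum_same_difference_le (hS : GoodDifferences S m) {F : Finset (G × G)} {f : G × G}
    (hf : f.2 ∈ S) {p : ℝ} (hp : 0 ≤ p) (hp2 : p ≤ 1 / 2) :
    ∑ g ∈ F with g.2 = f.2 ∧ g ≠ f ∧ ¬ Disjoint (progression m f) (progression m g),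
      p ^ (progression m f ∪ progression m g).card ≤ 4 * p ^ (m + 1) := by
  obtain ⟨a, s⟩ := f
  have hp1 : p ≤ 1 := by linarith
  set T : ℕ → Finset (G × G) := fun e => {(a + e • s, s), (a - e • s, s)} with hT
  have hsub : {g ∈ F | g.2 = s ∧ g ≠ (a, s) ∧
      ¬ Disjoint (progression m (a, s)) (progression m g)} ⊆ (Finset.Ico 1 m).biUnion T := by
    rintro ⟨b, t⟩ hg
    obtain ⟨-, rfl, hne, hd⟩ := Finset.mem_filter.1 hg
    simp only at *
    obtain ⟨x, hx, hx'⟩ := Finset.not_disjoint_iff.1 hd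
    obtain ⟨i, hi, e⟩ := mem_progression.1 hx
    obtain ⟨l, hl, e'⟩ := mem_progression.1 hx'
    simp only at e e'
    rw [Finset.mem_biUnion]
    have hb : b = a + i • t - l • t := by rw [e, ← e']; abel
    have hne' : i ≠ l := by
      rintro rfl
      exact hne (by rw [hb]; simp)
    rcases lt_or_gt_of_ne hne' with hlt | hlt
    · refine ⟨l - i, by rw [Finset.mem_Ico]; omega, ?_⟩
      have : l • t = (l - i) • t + i • t := by rw [← add_nsmul]; congr 1; omega
      have hb' : b = a - (l - i) • t := by rw [hb, this]; abel
      simp [hT, ← hb']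
    · refine ⟨i - l, by rw [Finset.mem_Ico]; omega, ?_⟩
      have : i • t = (i - l) • t + l • t := by rw [← add_nsmul]; congr 1; omega
      have hb' : b = a + (i - l) • t := by rw [hb, this]; abel
      simp [hT, ← hb']
  have hw : ∀ e ∈ Finset.Ico 1 m, ∑ g ∈ T e, p ^ (progression m (a, s) ∪ progression m g).card ≤
      2 * p ^ (m + e) := by
    intro e he
    have he' := (Finset.mem_Ico.1 he).2
    have h1 : ∀ g ∈ T e, p ^ (progression m (a, s) ∪ progression m g).card ≤ p ^ (m + e) := by
      intro g hg
      apply pow_le_pow_of_le_one hp hp1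
      simp only [hT, Finset.mem_insert, Finset.mem_singleton] at hg
      rcases hg with rfl | rfl
      · exact hS.le_card_union hf he'
      · have := hS.le_card_union (a := a - e • s) hf he'
        rw [sub_add_cancel] at this
        rwa [Finset.union_comm]
    refine (Finset.sum_le_card_nsmul _ _ _ h1).trans ?_
    rw [nsmul_eq_mul]
    refine mul_le_mul_of_nonneg_right ?_ (pow_nonneg hp _)
    exact_mod_cast Finset.card_le_two
  have hgeom : ∀ k : ℕ, ∑ e ∈ Finset.Ico 1 k, p ^ (m + e) ≤ 2 * p ^ (m + 1) := by
    intro k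
    rw [Finset.sum_Ico_eq_sum_range]
    have : ∀ i, p ^ (m + (1 + i)) = p ^ (m + 1) * p ^ i := fun i => by rw [← pow_add, add_assoc]
    simp only [this]
    rw [← Finset.mul_sum, mul_comm]
    refine mul_le_mul_of_nonneg_right ?_ (pow_nonneg hp _)
    have hs := (summable_geometric_of_lt_one hp (by linarith)).sum_le_tsum (Finset.range (k - 1))
      (fun i _ => pow_nonneg hp i)
    rw [tsum_geometric_of_lt_one hp (by linarith)] at hs
    refine hs.trans ?_
    rw [inv_le_comm₀ (by linarith) (by norm_num)]; linarith
  calc _ ≤ ∑ g ∈ (Finset.Ico 1 m).biUnion T,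
        p ^ (progression m (a, s) ∪ progression m g).card :=
        Finset.sum_le_sum_of_subset_of_nonneg hsub fun _ _ _ => pow_nonneg hp _
    _ ≤ ∑ e ∈ Finset.Ico 1 m, ∑ g ∈ T e, p ^ (progression m (a, s) ∪ progression m g).card :=
        sum_biUnion_le _ _ fun _ => pow_nonneg hp _
    _ ≤ ∑ e ∈ Finset.Ico 1 m, 2 * p ^ (m + e) := Finset.sum_le_sum hw
    _ ≤ _ := by rw [← Finset.mul_sum]; linarith [hgeom m]

/-- The difference of `g` and the indices of one common point in `f` and in `g` determine `g`. -/
theorem card_filter_not_disjoint_le {F : Finset (G × G)} (hF : ∀ g ∈ F, g.2 ∈ S) (f : G × G) :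
    {g ∈ F | ¬ Disjoint (progression m f) (progression m g)}.card ≤ m ^ 2 * S.card := by
  have hsub : {g ∈ F | ¬ Disjoint (progression m f) (progression m g)} ⊆
      (Finset.range m ×ˢ Finset.range m ×ˢ S).image
        fun q => (f.1 + q.1 • f.2 - q.2.1 • q.2.2, q.2.2) := by
    rintro ⟨b, t⟩ hg
    obtain ⟨hgF, hd⟩ := Finset.mem_filter.1 hg
    obtain ⟨x, hx, hx'⟩ := Finset.not_disjoint_iff.1 hd
    obtain ⟨i, hi, e⟩ := mem_progression.1 hx
    obtain ⟨l, hl, e'⟩ := mem_progression.1 hx'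
    refine Finset.mem_image.2 ⟨(i, l, t), by simp [hi, hl, hF _ hgF], ?_⟩
    simp only at *
    rw [e, ← e', add_sub_cancel_right]
  refine (Finset.card_le_card hsub).trans (Finset.card_image_le.trans ?_)
  simp only [Finset.card_product, Finset.card_range]
  rw [sq, mul_assoc]

/-- Two common points, with indices i, i' in `f` and l < l' in `g`, force (l' - l) • g.2 = (i' - i)
• f.2. Each of the m⁴ index quadruples leaves at most m differences, and the difference then fixes
the starting point. -/
theorem card_filter_two_le_card_inter_le (hS : GoodDifferences S m) {F : Finset (G × G)}
    (hF : ∀ g ∈ F, g.2 ∈ S) (f : G × G) :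
    {g ∈ F | 2 ≤ (progression m f ∩ progression m g).card}.card ≤ m ^ 5 := by
  set R := Finset.range m with hR
  let T : ℕ × ℕ × ℕ × ℕ → Finset (G × G) := fun q =>
    ({t ∈ S | q.1 < q.2.1 ∧ (q.2.1 - q.1) • t = ((q.2.2.2 : ℤ) - q.2.2.1) • f.2}).image
      fun t => (f.1 + q.2.2.1 • f.2 - q.1 • t, t)
  have hT : ∀ q ∈ R ×ˢ R ×ˢ R ×ˢ R, (T q).card ≤ m := by
    rintro ⟨l, l', i, i'⟩ hq
    simp only [hR, Finset.mem_product, Finset.mem_range] at hq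
    refine Finset.card_image_le.trans ?_
    by_cases hl : l < l'
    · simp only [hl, true_and]
      exact hS.card_nsmul_eq_le _ _ (by omega) (by omega)
    · simp [hl]
  have hsub : {g ∈ F | 2 ≤ (progression m f ∩ progression m g).card} ⊆
      (R ×ˢ R ×ˢ R ×ˢ R).biUnion T := by
    rintro ⟨b, t⟩ hg
    obtain ⟨hgF, h2⟩ := Finset.mem_filter.1 hg
    obtain ⟨x, hx, y, hy, hxy⟩ := Finset.one_lt_card.1 h2
    obtain ⟨hxf, hxg⟩ := Finset.mem_inter.1 hx
    obtain ⟨hyf, hyg⟩ := Finset.mem_inter.1 hy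
    obtain ⟨i, hi, ex⟩ := mem_progression.1 hxf
    obtain ⟨i', hi', ey⟩ := mem_progression.1 hyf
    obtain ⟨l, hl, ex'⟩ := mem_progression.1 hxg
    obtain ⟨l', hl', ey'⟩ := mem_progression.1 hyg
    simp only at *
    have main : ∀ i < m, ∀ i' < m, ∀ l < m, ∀ l' < m, l < l' → f.1 + i • f.2 = b + l • t →
        f.1 + i' • f.2 = b + l' • t → (b, t) ∈ (R ×ˢ R ×ˢ R ×ˢ R).biUnion T := by
      intro i hi i' hi' l hl l' hl' hlt e1 e2
      refine Finset.mem_biUnion.2 ⟨(l, l', i, i'), by simp [*], ?_⟩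
      refine Finset.mem_image.2 ⟨t, Finset.mem_filter.2 ⟨hF _ hgF, hlt, ?_⟩, ?_⟩
      · simp only
        rw [sub_zsmul, natCast_zsmul, natCast_zsmul]
        have : l' • t = (l' - l) • t + l • t := by rw [← add_nsmul]; congr 1; omega
        rw [this, ← add_assoc, add_right_comm, ← e1] at e2
        rw [add_assoc] at e2
        rw [add_left_cancel e2]; abel
      · simp only
        rw [e1, add_sub_cancel_right]
    have hll : l ≠ l' := by rintro rfl; exact hxy (ex'.symm.trans ey')
    rcases lt_or_gt_of_ne hll with h | h
    · exact main i hi i' hi' l hl l' hl' h (ex.trans ex'.symm) (ey.trans ey'.symm)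
    · exact main i' hi' i hi l' hl' l hl h (ey.trans ey'.symm) (ex.trans ex'.symm)
  refine (Finset.card_le_card hsub).trans (Finset.card_biUnion_le.trans ?_)
  refine (Finset.sum_le_card_nsmul _ _ _ hT).trans ?_
  simp only [hR, Finset.card_product, Finset.card_range, smul_eq_mul]
  apply le_of_eq; ring

/-- The total weight of the progressions that meet a given one. -/
theorem sum_pow_card_union_le (hS : GoodDifferences S m) {F : Finset (G × G)}
    (hF : ∀ g ∈ F, g.2 ∈ S) {f : G × G} (hf : f.2 ∈ S) {p : ℝ} (hp : 0 ≤ p) (hp2 : p ≤ 1 / 2) :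
    ∑ g ∈ F with g ≠ f ∧ ¬ Disjoint (progression m f) (progression m g),
      p ^ (progression m f ∪ progression m g).card ≤
    m ^ 2 * S.card * p ^ (2 * m - 1) + m ^ 5 * p ^ (2 * m - (m + 1) / 2) + 4 * p ^ (m + 1) := by
  have hp1 : p ≤ 1 := by linarith
  have hcard : ∀ g ∈ F, (progression m f ∪ progression m g).card +
      (progression m f ∩ progression m g).card = 2 * m := by
    intro g hg
    have hm : m ≤ m ^ 2 + 1 := by nlinarith
    rw [Finset.card_union_add_card_inter, hS.card_progression hf hm,
      hS.card_progression (hF g hg) hm, two_mul]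
  have h1 := hS.sum_same_difference_le (F := F) hf hp hp2
  have h2 : ∑ g ∈ F with ¬ Disjoint (progression m f) (progression m g), p ^ (2 * m - 1) ≤
      m ^ 2 * S.card * p ^ (2 * m - 1) := by
    rw [Finset.sum_const, nsmul_eq_mul]
    refine mul_le_mul_of_nonneg_right ?_ (pow_nonneg hp _)
    exact_mod_cast card_filter_not_disjoint_le hF f
  have h3 : ∑ g ∈ F with 2 ≤ (progression m f ∩ progression m g).card,
      p ^ (2 * m - (m + 1) / 2) ≤ m ^ 5 * p ^ (2 * m - (m + 1) / 2) := by
    rw [Finset.sum_const, nsmul_eq_mul]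
    refine mul_le_mul_of_nonneg_right ?_ (pow_nonneg hp _)
    exact_mod_cast hS.card_filter_two_le_card_inter_le hF f
  refine le_trans ?_ (add_le_add (add_le_add h2 h3) h1)
  -- Compared term by term: equal differences are charged to the third sum, two or more common
  -- points to the second, a single common point to the first.
  simp only [Finset.sum_filter]
  rw [← Finset.sum_add_distrib, ← Finset.sum_add_distrib]
  refine Finset.sum_le_sum fun g hg => ?_
  have n0 : ∀ k, 0 ≤ p ^ k := fun k => pow_nonneg hp k
  by_cases hd : Disjoint (progression m f) (progression m g)
  · simp only [hd, not_true, and_false, if_false]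
    split_ifs <;> simp [n0]
  by_cases hgf : g = f
  · simp only [hgf, ne_eq, not_true, false_and, if_false]
    split_ifs <;> simp [n0, add_nonneg]
  have hpos : 0 < (progression m f ∩ progression m g).card := by
    rw [Finset.card_pos]; exact Finset.not_disjoint_iff_nonempty_inter.1 hd
  by_cases hs : g.2 = f.2
  · simp only [hd, hgf, hs, ne_eq, not_false_eq_true, and_self, if_true]
    have : 0 ≤ if 2 ≤ (progression m f ∩ progression m g).card then
      p ^ (2 * m - (m + 1) / 2) else 0 := by split_ifs <;> simp [n0]
    linarith [n0 (2 * m - 1)]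
  · simp only [hd, hgf, hs, ne_eq, not_false_eq_true, and_self, if_true, false_and, if_false,
      add_zero]
    have hc := hcard g hg
    have hle := hS.card_inter_le hf (hF g hg) hs
    split_ifs with h2'
    · have := pow_le_pow_of_le_one hp hp1 (show 2 * m - (m + 1) / 2 ≤
        (progression m f ∪ progression m g).card by omega)
      linarith [n0 (2 * m - 1)]
    · have := pow_le_pow_of_le_one hp hp1 (show 2 * m - 1 ≤
        (progression m f ∪ progression m g).card by omega)
      linarith

end GoodDifferences

end Progressions

/-! ### The probabilistic bounds specialised to progressions. -/

section FiniteBounds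

namespace IsBernoulliFamily

variable {Ω G : Type*} [MeasurableSpace Ω] {P : Measure Ω} {V : Finset G} {E : G → Set Ω} {p : ℝ}

theorem comap {H : Type*} (h : IsBernoulliFamily P V E p) {U : Finset H} {φ : H → G}
    (hφ : ∀ i ∈ U, φ i ∈ V) (hinj : Set.InjOn φ U) :
    IsBernoulliFamily P U (fun i => E (φ i)) p := by
  classical
  refine ⟨fun i hi => h.measurableSet _ (hφ i hi), fun S hS => ?_⟩
  have e : allOccur (fun i => E (φ i)) S = allOccur E (S.image φ) := by
    ext ω; simp [mem_allOccur]
  rw [e, h.real_allOccur, Finset.card_image_of_injOn (hinj.mono (by exact_mod_cast hS))]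
  intro x hx
  obtain ⟨i, hi, rfl⟩ := Finset.mem_image.1 hx
  exact hφ i (hS hi)

variable [IsProbabilityMeasure P] [AddCommGroup G] [DecidableEq G] {S : Finset G} {m : ℕ}

theorem abs_real_noneOccur_progression_sub_le (h : IsBernoulliFamily P V E p) (hp : 0 ≤ p)
    (hp2 : p ≤ 1 / 2) (hS : GoodDifferences S m) {F : Finset (G × G)} (hF : ∀ f ∈ F, f.2 ∈ S)
    (hV : ∀ f ∈ F, progression m f ⊆ V) :
    |P.real (noneOccur E (progression m) F) - (1 - p ^ m) ^ F.card| ≤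
      F.card * (2 * (m ^ 2 * S.card * p ^ (2 * m - 1)) + m ^ 5 * p ^ (2 * m - (m + 1) / 2) +
        4 * p ^ (m + 1)) := by
  have hm : m ≤ m ^ 2 + 1 := by nlinarith
  have hc : ∀ f ∈ F, (progression m f).card = m := fun f hf => hS.card_progression (hF f hf) hm
  have key := h.abs_real_noneOccur_sub_prod_le hp (by linarith) F hV
  rw [Finset.prod_congr rfl (fun f hf => by rw [hc f hf]), Finset.prod_const] at key
  refine key.trans ?_
  rw [← nsmul_eq_mul]
  refine Finset.sum_le_card_nsmul _ _ _ fun f hf => ?_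
  rw [Finset.sum_add_distrib]
  have h1 := hS.sum_pow_card_union_le hF (hF f hf) hp hp2
  -- The product terms p^(2m) are absorbed into the one-point bound, hence its factor 2.
  have h2 : ∑ g ∈ F with g ≠ f ∧ ¬ Disjoint (progression m f) (progression m g),
      p ^ ((progression m f).card + (progression m g).card) ≤
      m ^ 2 * S.card * p ^ (2 * m - 1) := by
    refine (Finset.sum_le_card_nsmul _ _ (p ^ (2 * m - 1)) fun g hg => ?_).trans ?_
    · rw [hc f hf, hc g (Finset.mem_filter.1 hg).1]
      exact pow_le_pow_of_le_one hp (by linarith) (by omega)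
    · rw [nsmul_eq_mul]
      refine mul_le_mul_of_nonneg_right ?_ (pow_nonneg hp _)
      refine le_trans ?_ (show (({g ∈ F | ¬ Disjoint (progression m f)
        (progression m g)}.card : ℕ) : ℝ) ≤ _ by
          exact_mod_cast GoodDifferences.card_filter_not_disjoint_le hF f)
      exact_mod_cast Finset.card_le_card fun g hg => by
        rw [Finset.mem_filter] at hg ⊢
        exact ⟨hg.1, hg.2.2⟩
  linarith

theorem real_noneOccur_progression_le (h : IsBernoulliFamily P V E p) (hp : 0 < p)
    (hp2 : p ≤ 1 / 2) (hm1 : 1 ≤ m) (hS : GoodDifferences S m) {F : Finset (G × G)}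
    (hF : ∀ f ∈ F, f.2 ∈ S) (hV : ∀ f ∈ F, progression m f ⊆ V) (hF0 : 0 < F.card) :
    P.real (noneOccur E (progression m) F) ≤
      m ^ 2 * S.card / (F.card * p) + m ^ 5 / (F.card * p ^ ((m + 1) / 2)) +
        5 / (F.card * p ^ m) := by
  have hm : m ≤ m ^ 2 + 1 := by nlinarith
  have hc : ∀ f ∈ F, (progression m f).card = m := fun f hf => hS.card_progression (hF f hf) hm
  have key := h.real_noneOccur_mul_sq_le hp.le F hV
  rw [Finset.sum_congr rfl (fun f hf => by rw [hc f hf]), Finset.sum_const, nsmul_eq_mul] at key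
  have hb : ∀ f ∈ F, ∑ g ∈ F with ¬ Disjoint (progression m f) (progression m g),
      p ^ (progression m f ∪ progression m g).card ≤
      m ^ 2 * S.card * p ^ (2 * m - 1) + m ^ 5 * p ^ (2 * m - (m + 1) / 2) + 5 * p ^ m := by
    intro f hf
    have h1 := hS.sum_pow_card_union_le hF (hF f hf) hp.le hp2
    -- Unlike in the local dependence bound, the diagonal g = f counts here; its p^m and the 4
    -- p^(m+1) of the shifts make up 5 p^m.
    have h2 : ∑ g ∈ F with ¬ Disjoint (progression m f) (progression m g),
        p ^ (progression m f ∪ progression m g).card ≤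
        p ^ m + ∑ g ∈ F with g ≠ f ∧ ¬ Disjoint (progression m f) (progression m g),
        p ^ (progression m f ∪ progression m g).card := by
      have e : p ^ m = p ^ (progression m f ∪ progression m f).card := by
        rw [Finset.union_self, hc f hf]
      rw [e, ← Finset.sum_insert (f := fun g => p ^ (progression m f ∪ progression m g).card)
        (by simp)]
      refine Finset.sum_le_sum_of_subset_of_nonneg (fun g hg => ?_)
        fun _ _ _ => pow_nonneg hp.le _
      rw [Finset.mem_filter] at hg
      by_cases hgf : g = f
      · simp [hgf]
      · simp [hgf, hg]
    have h3 : p ^ (m + 1) ≤ p ^ m := pow_le_pow_of_le_one hp.le (by linarith) (by omega)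
    linarith
  have key2 := key.trans (Finset.sum_le_card_nsmul _ _ _ hb)
  rw [nsmul_eq_mul] at key2
  have hN : (0 : ℝ) < F.card := by exact_mod_cast hF0
  have hpm : 0 < p ^ m := pow_pos hp _
  rw [← le_div_iff₀ (by positivity)] at key2
  refine key2.trans (le_of_eq ?_)
  have e1 : p ^ (2 * m - 1) = (p ^ m) ^ 2 / p := by
    rw [eq_div_iff hp.ne', ← pow_succ, ← pow_mul]; congr 1; omega
  have e2 : p ^ (2 * m - (m + 1) / 2) = (p ^ m) ^ 2 / p ^ ((m + 1) / 2) := by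
    rw [eq_div_iff (pow_pos hp _).ne', ← pow_add, ← pow_mul]; congr 1; omega
  rw [e1, e2]
  have := pow_pos hp ((m + 1) / 2)
  field_simp

end IsBernoulliFamily

theorem isBernoulliFamily_of_iIndepFun {Ω : Type*} [MeasurableSpace Ω] {P : Measure Ω}
    [IsProbabilityMeasure P] {n : ℕ} {p : ℝ} (hp : 0 ≤ p) {ξ : ℕ → Ω → ℕ}
    (hmeas : ∀ i ∈ Finset.Icc 1 n, Measurable (ξ i))
    (hindep : iIndepFun (fun (i : Finset.Icc 1 n) => ξ i) P)
    (hone : ∀ i ∈ Finset.Icc 1 n, P {ω | ξ i ω = 1} = ENNReal.ofReal p) :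
    IsBernoulliFamily P (Finset.Icc 1 n) (fun i => {ω | ξ i ω = 1}) p := by
  refine ⟨fun i hi => hmeas i hi (measurableSet_singleton 1), fun S hS => ?_⟩
  have key := hindep.measure_inter_preimage_eq_mul (S.subtype (· ∈ Finset.Icc 1 n))
    (sets := fun _ => {1}) (fun _ _ => measurableSet_singleton 1)
  have e : allOccur (fun i => {ω | ξ i ω = 1}) S =
      ⋂ i ∈ S.subtype (· ∈ Finset.Icc 1 n), (ξ (i : ℕ)) ⁻¹' {1} := by
    ext ω
    simp only [mem_allOccur, Set.mem_ofPred_eq, Finset.mem_subtype, Set.mem_iInter,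
      Set.mem_preimage, Set.mem_singleton_iff, Subtype.forall]
    exact ⟨fun h i _ hi => h i hi, fun h i hi => h i (hS hi) hi⟩
  have hc : (S.subtype (· ∈ Finset.Icc 1 n)).card = S.card := by
    rw [Finset.card_subtype, Finset.filter_true_of_mem fun i hi => hS hi]
  rw [measureReal_def, e, key, Finset.prod_congr rfl (fun i _ => hone i.1 i.2),
    Finset.prod_const, ENNReal.toReal_pow, ENNReal.toReal_ofReal hp, hc]

end FiniteBounds

/-! ### Longest progressions as events about progressions in ℤ and `ZMod n`. -/

section LongestProgressions

theorem le_longestAP_iff {n m : ℕ} {x : ℕ → ℕ} (hm : 1 ≤ m) :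
    m ≤ longestAP n x ↔ ∃ a ∈ Finset.Icc 1 n, ∃ s ∈ Finset.Icc 1 n, a + (m - 1) * s ≤ n ∧
      ∀ j < m, x (a + j * s) = 1 := by
  have hm0 : (⊥ : ℕ) < m := hm
  simp only [longestAP, apLengthFrom, Finset.le_sup_iff hm0, Finset.mem_filter, Finset.mem_Icc, id]
  refine exists_congr fun a => and_congr_right fun ha => exists_congr fun s =>
    and_congr_right fun hs => ?_
  have key : ∀ k, 1 ≤ k → (k ≤ 1 + (n - a) / s ↔ a + (k - 1) * s ≤ n) := by
    intro k hk
    rw [show k ≤ 1 + (n - a) / s ↔ k - 1 ≤ (n - a) / s by omega, Nat.le_div_iff_mul_le hs.1]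
    omega
  constructor
  · rintro ⟨k, ⟨⟨h1, h2⟩, h3⟩, hmk⟩
    exact ⟨(key m hm).1 (hmk.trans h2), fun j hj => h3 j (hj.trans_le hmk)⟩
  · rintro ⟨h1, h2⟩
    exact ⟨m, ⟨⟨hm, (key m hm).2 h1⟩, h2⟩, le_rfl⟩

theorem le_longestModAP_iff {n m : ℕ} {x : ℕ → ℕ} (hm : 1 ≤ m) :
    m ≤ longestModAP n x ↔ ∃ a ∈ Finset.Icc 1 n, ∃ s ∈ Finset.Icc 1 n, m ≤ n / Nat.gcd s n ∧
      ∀ j < m, x (modRep n (a + j * s)) = 1 := by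
  have hm0 : (⊥ : ℕ) < m := hm
  simp only [longestModAP, modAPLengthFrom, Finset.le_sup_iff hm0, Finset.mem_filter,
    Finset.mem_Icc, id]
  refine exists_congr fun a => and_congr_right fun ha => exists_congr fun s =>
    and_congr_right fun hs => ?_
  constructor
  · rintro ⟨k, ⟨⟨h1, h2⟩, h3⟩, hmk⟩
    exact ⟨hmk.trans h2, fun j hj => h3 j (hj.trans_le hmk)⟩
  · rintro ⟨h1, h2⟩
    exact ⟨m, ⟨⟨hm, h1⟩, h2⟩, le_rfl⟩

/-- The progressions of length `m` in `{1, …, n}`. -/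
noncomputable def intProgressions (n m : ℕ) : Finset (ℤ × ℤ) :=
  (Finset.Icc 1 (n : ℤ) ×ˢ Finset.Icc 1 (n : ℤ)).filter
    fun f => f.1 + ((m : ℤ) - 1) * f.2 ≤ n

theorem mem_intProgressions {n m : ℕ} {f : ℤ × ℤ} : f ∈ intProgressions n m ↔
    ((1 ≤ f.1 ∧ f.1 ≤ n) ∧ 1 ≤ f.2 ∧ f.2 ≤ n) ∧ f.1 + ((m : ℤ) - 1) * f.2 ≤ n := by
  simp [intProgressions]

theorem progression_subset_Icc {n m : ℕ} {f : ℤ × ℤ} (hf : f ∈ intProgressions n m) :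
    progression m f ⊆ Finset.Icc 1 (n : ℤ) := by
  intro x hx
  obtain ⟨i, hi, rfl⟩ := mem_progression.1 hx
  obtain ⟨⟨⟨h1, h2⟩, h3, h4⟩, h5⟩ := mem_intProgressions.1 hf
  rw [Finset.mem_Icc, nsmul_eq_mul]
  have hi' : (i : ℤ) ≤ m - 1 := by omega
  constructor <;> nlinarith

theorem le_longestAP_iff_int {n m : ℕ} {x : ℕ → ℕ} (hm : 1 ≤ m) :
    m ≤ longestAP n x ↔ ∃ f ∈ intProgressions n m, ∀ i ∈ progression m f, x i.toNat = 1 := by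
  rw [le_longestAP_iff hm]
  constructor
  · rintro ⟨a, ha, s, hs, h1, h2⟩
    rw [Finset.mem_Icc] at ha hs
    refine ⟨(a, s), mem_intProgressions.2 ⟨⟨⟨?_, ?_⟩, ?_, ?_⟩, ?_⟩, fun i hi => ?_⟩
    · simp only; omega
    · simp only; omega
    · simp only; omega
    · simp only; omega
    · zify [hm] at h1; exact h1
    · obtain ⟨j, hj, rfl⟩ := mem_progression.1 hi
      rw [← h2 j hj]; congr 1
  · rintro ⟨⟨a, s⟩, hf, h⟩
    obtain ⟨⟨⟨h1, h2⟩, h3, h4⟩, h5⟩ := mem_intProgressions.1 hf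
    simp only at *
    lift a to ℕ using by omega
    lift s to ℕ using by omega
    refine ⟨a, by rw [Finset.mem_Icc]; omega, s, by rw [Finset.mem_Icc]; omega, ?_, fun j hj => ?_⟩
    · zify [hm]; exact h5
    · rw [← h _ (mem_progression.2 ⟨j, hj, rfl⟩)]; congr 1

theorem goodDifferences_int (n m : ℕ) : GoodDifferences (Finset.Icc 1 (n : ℤ)) m where
  nsmul_ne_zero s hs j hj _ := by
    rw [Finset.mem_Icc] at hs
    rw [nsmul_eq_mul]
    have : (1 : ℤ) ≤ j := by exact_mod_cast hj
    nlinarith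
  neg_notMem s hs := by
    rw [Finset.mem_Icc] at hs ⊢; omega
  card_nsmul_eq_le d x hd hdm := by
    refine le_trans (Finset.card_le_one.2 fun a ha b hb => ?_) (by omega : 1 ≤ m)
    have h1 := (Finset.mem_filter.1 ha).2.trans (Finset.mem_filter.1 hb).2.symm
    rw [nsmul_eq_mul, nsmul_eq_mul] at h1
    exact mul_left_cancel₀ (by exact_mod_cast (by omega : d ≠ 0)) h1

/-- Residues with a vanishing multiple `j • s`, `1 ≤ j ≤ m ^ 2`. -/
def smallOrder (n m : ℕ) [NeZero n] : Finset (ZMod n) :=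
  (Finset.Icc 1 (m ^ 2)).biUnion fun j => Finset.univ.filter fun s => j • s = 0

/-- The residues of large order in the first half of `ZMod n`. -/
def modDifferences (n m : ℕ) [NeZero n] : Finset (ZMod n) :=
  Finset.univ.filter fun s => s ∉ smallOrder n m ∧ 2 * s.val < n

section ZMod

variable {n m : ℕ}

theorem modRep_val_natCast (k : ℕ) : modRep n (k : ZMod n).val = modRep n k := by
  rw [ZMod.val_natCast, modRep, modRep, Nat.mod_mod]

theorem card_progression_of_le_addOrderOf {f : ZMod n × ZMod n} (h : m ≤ addOrderOf f.2) :
    (progression m f).card = m := by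
  rw [progression, Finset.card_image_of_injOn, Finset.card_range]
  intro i hi j hj hij
  simp only [Finset.coe_range, Set.mem_Iio] at hi hj
  exact nsmul_injOn_Iio_addOrderOf (Set.mem_Iio.2 (hi.trans_le h)) (Set.mem_Iio.2 (hj.trans_le h))
    (add_left_cancel hij)

/-- Differences therefore matter only up to sign, which is where the 1/2 in the mod `n` count comes
from. -/
theorem progression_reverse (f : ZMod n × ZMod n) :
    progression m (f.1 + (m - 1) • f.2, -f.2) = progression m f := by
  have key : ∀ (a s : ZMod n) (i : ℕ), i < m →
      a + (m - 1) • s + i • (-s) = a + (m - 1 - i) • s := by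
    intro a s i hi
    have : (m - 1) • s = (m - 1 - i) • s + i • s := by rw [← add_nsmul]; congr 1; omega
    rw [this, smul_neg]; abel
  ext x
  simp only [mem_progression]
  constructor
  · rintro ⟨i, hi, rfl⟩
    exact ⟨m - 1 - i, by omega, (key _ _ i hi).symm⟩
  · rintro ⟨i, hi, rfl⟩
    refine ⟨m - 1 - i, by omega, ?_⟩
    rw [key _ _ _ (by omega)]
    congr 2; omega

variable [NeZero n]

theorem mem_smallOrder {s : ZMod n} :
    s ∈ smallOrder n m ↔ ∃ j : ℕ, (1 ≤ j ∧ j ≤ m ^ 2) ∧ j • s = 0 := by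
  simp only [smallOrder, Finset.mem_biUnion, Finset.mem_Icc, Finset.mem_filter, Finset.mem_univ,
    true_and]

theorem mem_modDifferences {s : ZMod n} :
    s ∈ modDifferences n m ↔ s ∉ smallOrder n m ∧ 2 * s.val < n := by
  simp [modDifferences]

/-- In a cyclic group j • s = 0 has at most j solutions, and j takes m² values up to m². -/
theorem card_smallOrder_le : (smallOrder n m).card ≤ m ^ 4 := by
  refine (Finset.card_biUnion_le_card_mul _ _ (m ^ 2) fun j hj => ?_).trans ?_
  · rw [Finset.mem_Icc] at hj
    exact (IsAddCyclic.card_nsmul_eq_zero_le (by omega)).trans hj.2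
  · rw [Nat.card_Icc, Nat.add_sub_cancel, ← pow_add]

theorem card_filter_two_mul_val_lt :
    (Finset.univ.filter fun s : ZMod n => 2 * s.val < n).card = (n + 1) / 2 := by
  rw [← Finset.card_range ((n + 1) / 2)]
  refine Finset.card_bij (fun s _ => s.val) (fun s hs => ?_)
    (fun s _ t _ h => ZMod.val_injective n h) fun k hk => ?_
  · simp only [Finset.mem_filter, Finset.mem_univ, true_and] at hs
    rw [Finset.mem_range]; omega
  · rw [Finset.mem_range] at hk
    have hkn : k < n := by omega
    refine ⟨(k : ZMod n), ?_, ZMod.val_cast_of_lt hkn⟩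
    simp only [Finset.mem_filter, Finset.mem_univ, true_and, ZMod.val_cast_of_lt hkn]
    omega

theorem card_modDifferences_le : (modDifferences n m).card ≤ (n + 1) / 2 := by
  rw [← card_filter_two_mul_val_lt (n := n)]
  exact Finset.card_le_card fun s hs => by simpa using (mem_modDifferences.1 hs).2

theorem le_card_modDifferences : (n + 1) / 2 ≤ (modDifferences n m).card + m ^ 4 := by
  rw [← card_filter_two_mul_val_lt (n := n)]
  refine le_trans (Finset.card_le_card (t := modDifferences n m ∪ smallOrder n m) fun s hs => ?_)
    ((Finset.card_union_le _ _).trans (Nat.add_le_add_left card_smallOrder_le _))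
  by_cases h : s ∈ smallOrder n m
  · exact Finset.mem_union_right _ h
  · exact Finset.mem_union_left _ (mem_modDifferences.2 ⟨h, by simpa using hs⟩)

/-- Solutions of d • t = x differ by d-torsion elements, of which a cyclic group has at most d. Only
0 lies in the first half together with its negative, and 0 has small order. -/
theorem goodDifferences_zmod (hm : 1 ≤ m) : GoodDifferences (modDifferences n m) m where
  nsmul_ne_zero s hs j hj hjm h :=
    (mem_modDifferences.1 hs).1 (mem_smallOrder.2 ⟨j, ⟨hj, hjm⟩, h⟩)
  neg_notMem s hs hs' := by
    have h1 := (mem_modDifferences.1 hs).2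
    have h2 := (mem_modDifferences.1 hs').2
    rw [ZMod.neg_val] at h2
    split_ifs at h2 with h0
    · rw [mem_modDifferences, mem_smallOrder] at hs
      exact hs.1 ⟨1, ⟨le_rfl, Nat.one_le_pow _ _ hm⟩, by simp [h0]⟩
    · have := s.val_lt; omega
  card_nsmul_eq_le d x hd hdm := by
    by_cases hne : {t ∈ modDifferences n m | d • t = x}.Nonempty
    · obtain ⟨t₀, ht₀⟩ := hne
      have e₀ := (Finset.mem_filter.1 ht₀).2
      refine le_trans ?_ ((IsAddCyclic.card_nsmul_eq_zero_le (α := ZMod n)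
        (by omega : 0 < d)).trans hdm.le)
      refine Finset.card_le_card_of_injOn (fun t => t - t₀) (fun t ht => ?_)
        (fun a _ b _ h => sub_left_injective h)
      have e := (Finset.mem_filter.1 ht).2
      rw [Finset.mem_coe, Finset.mem_filter, nsmul_sub, e, e₀]
      exact ⟨Finset.mem_univ _, sub_self _⟩
    · rw [Finset.not_nonempty_iff_eq_empty.1 hne]; simp

theorem modRep_mem (k : ℕ) : modRep n k ∈ Finset.Icc 1 n := by
  have h0 : 0 < n := Nat.pos_of_ne_zero (NeZero.ne n)
  have := Nat.mod_lt k h0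
  rw [Finset.mem_Icc, modRep]; split_ifs <;> omega

theorem modRep_val_injective : Function.Injective fun i : ZMod n => modRep n i.val := by
  intro i j h
  apply ZMod.val_injective n
  have hi := i.val_lt
  have hj := j.val_lt
  simp only [modRep, Nat.mod_eq_of_lt hi, Nat.mod_eq_of_lt hj] at h
  split_ifs at h <;> omega

/-- The cap n / gcd(s, n) is the additive order of s in `ZMod n`. -/
theorem le_longestModAP_iff_zmod {x : ℕ → ℕ} (hm : 1 ≤ m) :
    m ≤ longestModAP n x ↔ ∃ f : ZMod n × ZMod n, m ≤ addOrderOf f.2 ∧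
      ∀ i ∈ progression m f, x (modRep n i.val) = 1 := by
  have hord : ∀ s : ℕ, n / Nat.gcd s n = addOrderOf (s : ZMod n) := fun s => by
    rw [ZMod.addOrderOf_coe _ (NeZero.ne n), Nat.gcd_comm]
  have hrep : ∀ z : ZMod n, ∃ k ∈ Finset.Icc 1 n, (k : ZMod n) = z := fun z => by
    refine ⟨modRep n z.val, modRep_mem _, ?_⟩
    rw [modRep, Nat.mod_eq_of_lt z.val_lt]
    split_ifs with h
    · rw [ZMod.natCast_self, (ZMod.val_eq_zero z).1 h]
    · exact ZMod.natCast_zmod_val z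
  rw [le_longestModAP_iff hm]
  constructor
  · rintro ⟨a, ha, s, hs, h1, h2⟩
    refine ⟨((a : ZMod n), (s : ZMod n)), by rwa [← hord], fun i hi => ?_⟩
    obtain ⟨j, hj, rfl⟩ := mem_progression.1 hi
    rw [← h2 j hj, ← modRep_val_natCast (a + j * s)]
    congr 3; push_cast; rw [nsmul_eq_mul]
  · rintro ⟨⟨a, s⟩, h1, h2⟩
    obtain ⟨a, ha, rfl⟩ := hrep a
    obtain ⟨s, hs, rfl⟩ := hrep s
    refine ⟨a, ha, s, hs, by rwa [hord], fun j hj => ?_⟩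
    rw [← h2 _ (mem_progression.2 ⟨j, hj, rfl⟩), ← modRep_val_natCast (a + j * s)]
    congr 3; push_cast; rw [nsmul_eq_mul]

theorem le_addOrderOf_of_notMem_smallOrder {s : ZMod n} (h : s ∉ smallOrder n m) :
    m ≤ addOrderOf s := by
  by_contra! hlt
  exact h (mem_smallOrder.2 ⟨addOrderOf s, ⟨addOrderOf_pos s, by nlinarith⟩,
    addOrderOf_nsmul_eq_zero s⟩)

theorem smallOrder_neg_iff {s : ZMod n} : -s ∈ smallOrder n m ↔ s ∈ smallOrder n m := by
  simp [mem_smallOrder]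

/-- Every progression of large order has the support of one with difference in
`modDifferences n m`. -/
theorem exists_modDifferences_progression_eq (hm : 2 ≤ m) {f : ZMod n × ZMod n}
    (hf : f.2 ∉ smallOrder n m) :
    ∃ g : ZMod n × ZMod n, g.2 ∈ modDifferences n m ∧ progression m g = progression m f := by
  by_cases h : 2 * f.2.val < n
  · exact ⟨f, mem_modDifferences.2 ⟨hf, h⟩, rfl⟩
  · refine ⟨_, mem_modDifferences.2 ⟨mt smallOrder_neg_iff.1 hf, ?_⟩, progression_reverse f⟩
    have hne : f.2 ≠ 0 := fun h0 => hf (mem_smallOrder.2 ⟨1, ⟨le_rfl, by nlinarith⟩, by simp [h0]⟩)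
    -- The residue n/2 equals its own negative, but it has order 2 ≤ m² and so is already excluded.
    have h2 : 2 * f.2.val ≠ n := by
      intro h2
      refine hf (mem_smallOrder.2 ⟨2, ⟨by norm_num, by nlinarith⟩, ?_⟩)
      have : ((2 * f.2.val : ℕ) : ZMod n) = 0 := by rw [h2, ZMod.natCast_self]
      push_cast at this
      rwa [ZMod.natCast_zmod_val, ← Nat.cast_two, ← nsmul_eq_mul] at this
    rw [ZMod.neg_val, if_neg hne]
    have := f.2.val_lt
    omega

end ZMod

end LongestProgressions

/-! ### Counting progressions, and explicit bounds for a single row. -/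

section RowBounds

theorem card_intProgressions {n d : ℕ} (hd : 1 ≤ d) :
    (intProgressions n (d + 1)).card = ∑ s ∈ Finset.Icc 1 (n / d), (n - d * s) := by
  have e : intProgressions n (d + 1) = (Finset.Icc 1 (n / d)).biUnion fun s =>
      (Finset.Icc 1 (n - d * s)).image fun a : ℕ => ((a : ℤ), (s : ℤ)) := by
    ext ⟨a, s⟩
    simp only [mem_intProgressions, Finset.mem_biUnion, Finset.mem_Icc, Finset.mem_image,
      Prod.mk.injEq, Nat.le_div_iff_mul_le hd]
    push_cast
    rw [add_sub_cancel_right]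
    constructor
    · rintro ⟨⟨⟨h1, h2⟩, h3, h4⟩, h5⟩
      lift a to ℕ using by omega
      lift s to ℕ using by omega
      have h5' : a + d * s ≤ n := by exact_mod_cast h5
      exact ⟨s, ⟨by omega, by rw [mul_comm]; omega⟩, a, ⟨by omega, by omega⟩, rfl, rfl⟩
    · rintro ⟨s, ⟨h1, h2⟩, a, ⟨h3, h4⟩, rfl, rfl⟩
      have h6 : a + d * s ≤ n := by rw [mul_comm] at h2; omega
      have h7 : s ≤ d * s := Nat.le_mul_of_pos_left _ hd
      refine ⟨⟨⟨?_, ?_⟩, ?_, ?_⟩, ?_⟩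
      · omega
      · omega
      · omega
      · omega
      · exact_mod_cast h6
  rw [e, Finset.card_biUnion]
  · refine Finset.sum_congr rfl fun s _ => ?_
    rw [Finset.card_image_of_injective _ (fun a b h => by simpa using h), Nat.card_Icc,
      Nat.add_sub_cancel]
  · intro s _ t _ hst
    refine Finset.disjoint_left.2 fun x hx hx' => hst ?_
    obtain ⟨a, -, rfl⟩ := Finset.mem_image.1 hx
    obtain ⟨b, -, h⟩ := Finset.mem_image.1 hx'
    simp only [Prod.mk.injEq] at h
    exact_mod_cast h.2.symm

theorem card_intProgressions_eq {n d : ℕ} (hd : 1 ≤ d) :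
    ((intProgressions n (d + 1)).card : ℝ) =
      (n / d : ℕ) * (2 * n - d - d * (n / d : ℕ)) / 2 := by
  rw [card_intProgressions hd]
  have key : ∀ q : ℕ, d * q ≤ n → ((∑ s ∈ Finset.Icc 1 q, (n - d * s) : ℕ) : ℝ) =
      q * (2 * n - d - d * q) / 2 := by
    intro q
    induction q with
    | zero => intro; simp
    | succ q ih =>
      intro h
      rw [Finset.sum_Icc_succ_top (by omega), Nat.cast_add, ih (by nlinarith), Nat.cast_sub h]
      push_cast; ring
  exact key _ (Nat.mul_div_le n d)

theorem card_intProgressions_le {n d : ℕ} (hd : 1 ≤ d) :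
    ((intProgressions n (d + 1)).card : ℝ) ≤ n ^ 2 / (2 * d) := by
  rw [card_intProgressions_eq hd]
  have hd' : (1 : ℝ) ≤ d := by exact_mod_cast hd
  set q : ℝ := ((n / d : ℕ) : ℝ) with hq
  have hq0 : 0 ≤ q := by positivity
  rw [div_le_div_iff₀ (by norm_num) (by positivity)]
  -- After clearing denominators the gap is (n - dq)² + d²q.
  nlinarith [sq_nonneg ((n : ℝ) - d * q), mul_nonneg (mul_nonneg hq0 (by linarith : (0:ℝ) ≤ d))
    (by linarith : (0:ℝ) ≤ d)]

theorem le_card_intProgressions {n d : ℕ} (hd : 1 ≤ d) (hdn : d ≤ n) :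
    (n : ℝ) ^ 2 / (2 * d) - n ≤ ((intProgressions n (d + 1)).card : ℝ) := by
  rw [card_intProgressions_eq hd]
  have hd' : (1 : ℝ) ≤ d := by exact_mod_cast hd
  have hdn' : (d : ℝ) ≤ n := by exact_mod_cast hdn
  have h1 : d * ((n / d : ℕ) : ℝ) ≤ n := by exact_mod_cast Nat.mul_div_le n d
  have h2 : (n : ℝ) < d * ((n / d : ℕ) : ℝ) + d := by
    exact_mod_cast (by simpa [mul_add] using Nat.lt_mul_div_succ n hd)
  set q : ℝ := ((n / d : ℕ) : ℝ) with hq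
  rw [sub_le_iff_le_add, div_le_iff₀ (by positivity)]
  -- With r = n - dq in [0, d), the claim is r² + d·dq ≤ 2dn; here r² ≤ d² ≤ dn and dq ≤ n.
  nlinarith [mul_nonneg (by linarith : 0 ≤ d * q + d - n) (by linarith : 0 ≤ (d : ℝ) + n - d * q),
    mul_nonneg (sub_nonneg.2 h1) (by linarith : (0:ℝ) ≤ d),
    mul_nonneg (sub_nonneg.2 hdn') (by linarith : (0:ℝ) ≤ d)]

variable {Ω : Type*} {n m : ℕ} {p : ℝ} {ξ : ℕ → Ω → ℕ}

theorem setOf_longestAP_lt (hm : 1 ≤ m) :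
    {ω | longestAP n (fun i => ξ i ω) < m} =
      noneOccur (fun i : ℤ => {ω | ξ i.toNat ω = 1}) (progression m) (intProgressions n m) := by
  ext ω
  rw [Set.mem_ofPred_eq, ← not_le, le_longestAP_iff_int hm, mem_noneOccur]
  push Not
  simp only [mem_allOccur, Set.mem_ofPred_eq]
  push Not
  rfl

theorem setOf_le_longestAP (hm : 1 ≤ m) :
    {ω | m ≤ longestAP n (fun i => ξ i ω)} =
      {ω | ∃ f ∈ intProgressions n m,
        ω ∈ allOccur (fun i : ℤ => {ω | ξ i.toNat ω = 1}) (progression m f)} := by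
  ext ω
  simp only [Set.mem_ofPred_eq, le_longestAP_iff_int hm, mem_allOccur]

variable [MeasurableSpace Ω] {P : Measure Ω}

theorem isBernoulliFamily_int
    (h : IsBernoulliFamily P (Finset.Icc 1 n) (fun i => {ω | ξ i ω = 1}) p) :
    IsBernoulliFamily P (Finset.Icc 1 (n : ℤ)) (fun i => {ω | ξ i.toNat ω = 1}) p :=
  h.comap (φ := Int.toNat) (fun i hi => by rw [Finset.mem_Icc] at hi ⊢; omega)
    (fun i hi j hj hij => by
      simp only [Finset.coe_Icc, Set.mem_Icc] at hi hj
      omega)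

theorem isBernoulliFamily_zmod [NeZero n]
    (h : IsBernoulliFamily P (Finset.Icc 1 n) (fun i => {ω | ξ i ω = 1}) p) :
    IsBernoulliFamily P Finset.univ (fun i : ZMod n => {ω | ξ (modRep n i.val) ω = 1}) p :=
  h.comap (φ := fun i : ZMod n => modRep n i.val) (fun _ _ => modRep_mem _)
    modRep_val_injective.injOn

theorem measurableSet_longestAP_lt
    (h : IsBernoulliFamily P (Finset.Icc 1 n) (fun i => {ω | ξ i ω = 1}) p) (hm : 1 ≤ m) :
    MeasurableSet {ω | longestAP n (fun i => ξ i ω) < m} := by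
  rw [setOf_longestAP_lt hm]
  exact (isBernoulliFamily_int h).measurableSet_noneOccur fun f hf => progression_subset_Icc hf

theorem snd_mem_of_mem_intProgressions {f : ℤ × ℤ} (hf : f ∈ intProgressions n m) :
    f.2 ∈ Finset.Icc 1 (n : ℤ) :=
  Finset.mem_Icc.2 (mem_intProgressions.1 hf).1.2

theorem real_le_longestAP_le
    (h : IsBernoulliFamily P (Finset.Icc 1 n) (fun i => {ω | ξ i ω = 1}) p) (hm : 1 ≤ m) :
    P.real {ω | m ≤ longestAP n (fun i => ξ i ω)} ≤ (intProgressions n m).card * p ^ m := by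
  rw [setOf_le_longestAP hm]
  refine ((isBernoulliFamily_int h).real_exists_allOccur_le _
    fun f hf => progression_subset_Icc hf).trans (le_of_eq ?_)
  rw [← nsmul_eq_mul, ← Finset.sum_const]
  exact Finset.sum_congr rfl fun f hf => by
    rw [(goodDifferences_int n m).card_progression (snd_mem_of_mem_intProgressions hf)
      (by nlinarith)]

theorem abs_real_longestAP_lt_sub_le [IsProbabilityMeasure P]
    (h : IsBernoulliFamily P (Finset.Icc 1 n) (fun i => {ω | ξ i ω = 1}) p) (hp : 0 ≤ p)
    (hp2 : p ≤ 1 / 2) (hm : 1 ≤ m) :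
    |P.real {ω | longestAP n (fun i => ξ i ω) < m} -
        (1 - p ^ m) ^ (intProgressions n m).card| ≤
      (intProgressions n m).card * (2 * (m ^ 2 * n * p ^ (2 * m - 1)) +
        m ^ 5 * p ^ (2 * m - (m + 1) / 2) + 4 * p ^ (m + 1)) := by
  rw [setOf_longestAP_lt hm]
  have := (isBernoulliFamily_int h).abs_real_noneOccur_progression_sub_le hp hp2
    (goodDifferences_int n m) (F := intProgressions n m)
    (fun f hf => snd_mem_of_mem_intProgressions hf) fun f hf => progression_subset_Icc hf
  simpa using this

theorem real_longestAP_lt_le [IsProbabilityMeasure P]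
    (h : IsBernoulliFamily P (Finset.Icc 1 n) (fun i => {ω | ξ i ω = 1}) p) (hp : 0 < p)
    (hp2 : p ≤ 1 / 2) (hm : 2 ≤ m) (hmn : 4 * m ≤ n) :
    P.real {ω | longestAP n (fun i => ξ i ω) < m} ≤
      4 * m ^ 3 / (n * p) + 4 * m ^ 6 / (n ^ 2 * p ^ ((m + 1) / 2)) +
        20 * m / (n ^ 2 * p ^ m) := by
  have hn : (0 : ℝ) < n := by exact_mod_cast (by omega : 0 < n)
  -- Since n ≥ 4m, the error term n in the count is at most half of n²/(2(m-1)).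
  have hN : (n : ℝ) ^ 2 / (4 * m) ≤ (intProgressions n m).card := by
    obtain ⟨d, rfl⟩ : ∃ d, m = d + 1 := ⟨m - 1, by omega⟩
    refine le_trans ?_ (le_card_intProgressions (by omega : 1 ≤ d) (by omega))
    have hd : (1 : ℝ) ≤ d := by exact_mod_cast (by omega : 1 ≤ d)
    have hdn : 4 * ((d : ℝ) + 1) ≤ n := by exact_mod_cast hmn
    have h1 : (n : ℝ) ^ 2 / (4 * (d + 1 : ℕ)) ≤ n ^ 2 / (4 * d) := by
      push_cast; gcongr; linarith
    have h2 : (n : ℝ) ^ 2 / (2 * d) - n - n ^ 2 / (4 * d) = n * (n - 4 * d) / (4 * d) := by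
      field_simp; ring
    have h3 : 0 ≤ n * (n - 4 * (d : ℝ)) / (4 * d) := by
      apply div_nonneg (mul_nonneg hn.le _) <;> linarith
    linarith
  have hm0 : (0 : ℝ) < m := by exact_mod_cast (by omega : 0 < m)
  have hN0 : (0 : ℝ) < (n : ℝ) ^ 2 / (4 * m) := by positivity
  have key := (isBernoulliFamily_int h).real_noneOccur_progression_le hp hp2 (by omega)
    (goodDifferences_int n m) (F := intProgressions n m)
    (fun f hf => snd_mem_of_mem_intProgressions hf) (fun f hf => progression_subset_Icc hf)
    (by exact_mod_cast hN0.trans_le hN)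
  rw [← setOf_longestAP_lt (by omega)] at key
  simp only [Int.card_Icc, add_sub_cancel_right, Int.toNat_natCast] at key
  refine key.trans ?_
  refine add_le_add (add_le_add ?_ ?_) ?_
  · calc (m : ℝ) ^ 2 * n / ((intProgressions n m).card * p) ≤
          m ^ 2 * n / (n ^ 2 / (4 * m) * p) := by gcongr
      _ = _ := by field_simp
  · calc (m : ℝ) ^ 5 / ((intProgressions n m).card * p ^ ((m + 1) / 2)) ≤
          m ^ 5 / (n ^ 2 / (4 * m) * p ^ ((m + 1) / 2)) := by gcongr
      _ = _ := by field_simp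
  · calc (5 : ℝ) / ((intProgressions n m).card * p ^ m) ≤
          5 / (n ^ 2 / (4 * m) * p ^ m) := by gcongr
      _ = _ := by field_simp; norm_num

section Mod

/-- The progressions mod `n` with difference in `modDifferences n m`. -/
def modProgressions (n m : ℕ) [NeZero n] : Finset (ZMod n × ZMod n) :=
  Finset.univ ×ˢ modDifferences n m

variable [NeZero n]

theorem card_modProgressions :
    (modProgressions n m).card = n * (modDifferences n m).card := by
  rw [modProgressions, Finset.card_product, Finset.card_univ, ZMod.card]

theorem mem_modProgressions {f : ZMod n × ZMod n} :
    f ∈ modProgressions n m ↔ f.2 ∈ modDifferences n m := by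
  simp [modProgressions]

/-- All pairs are counted, both signs and small orders included: a constant factor is harmless where
this is used. -/
theorem real_le_longestModAP_le
    (h : IsBernoulliFamily P (Finset.Icc 1 n) (fun i => {ω | ξ i ω = 1}) p) (hp : 0 ≤ p)
    (hm : 1 ≤ m) :
    P.real {ω | m ≤ longestModAP n (fun i => ξ i ω)} ≤ n ^ 2 * p ^ m := by
  set F : Finset (ZMod n × ZMod n) := Finset.univ.filter fun f => m ≤ addOrderOf f.2
  have e : {ω | m ≤ longestModAP n (fun i => ξ i ω)} =
      {ω | ∃ f ∈ F, ω ∈ allOccur (fun i : ZMod n => {ω | ξ (modRep n i.val) ω = 1})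
        (progression m f)} := by
    ext ω
    simp only [Set.mem_ofPred_eq, le_longestModAP_iff_zmod hm, mem_allOccur, F,
      Finset.mem_filter, Finset.mem_univ, true_and]
  rw [e]
  refine ((isBernoulliFamily_zmod h).real_exists_allOccur_le _
    fun f hf => Finset.subset_univ _).trans ?_
  have h1 : ∀ f ∈ F, p ^ (progression m f).card ≤ p ^ m := fun f hf => by
    rw [card_progression_of_le_addOrderOf (by simpa [F] using hf)]
  refine (Finset.sum_le_card_nsmul _ _ _ h1).trans ?_
  rw [nsmul_eq_mul]
  refine mul_le_mul_of_nonneg_right ?_ (pow_nonneg hp _)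
  have : F.card ≤ n ^ 2 := (Finset.card_le_univ _).trans (by
    rw [Fintype.card_prod, ZMod.card, sq])
  exact_mod_cast this

theorem setOf_longestModAP_lt_subset {Ω : Type*} {ξ : ℕ → Ω → ℕ} (hm : 1 ≤ m) :
    {ω | longestModAP n (fun i => ξ i ω) < m} ⊆
      noneOccur (fun i : ZMod n => {ω | ξ (modRep n i.val) ω = 1}) (progression m)
        (modProgressions n m) := by
  intro ω hω
  rw [mem_noneOccur]
  intro f hf hω'
  rw [mem_modProgressions, mem_modDifferences] at hf
  refine not_le.2 hω ((le_longestModAP_iff_zmod hm).2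
    ⟨f, le_addOrderOf_of_notMem_smallOrder hf.1, ?_⟩)
  have h := mem_allOccur.1 hω'
  exact h

/-- Converse of `setOf_longestModAP_lt_subset` up to an error: the progressions missed by
`modProgressions` have a difference in `smallOrder n m`, so there are at most n m⁴ of them. -/
theorem real_noneOccur_modProgressions_le [IsProbabilityMeasure P]
    (h : IsBernoulliFamily P (Finset.Icc 1 n) (fun i => {ω | ξ i ω = 1}) p) (hp : 0 ≤ p)
    (hm : 2 ≤ m) :
    P.real (noneOccur (fun i : ZMod n => {ω | ξ (modRep n i.val) ω = 1}) (progression m)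
        (modProgressions n m)) ≤
      P.real {ω | longestModAP n (fun i => ξ i ω) < m} + n * m ^ 4 * p ^ m := by
  set F : Finset (ZMod n × ZMod n) :=
    Finset.univ.filter fun f => m ≤ addOrderOf f.2 ∧ f.2 ∈ smallOrder n m
  have hsub : noneOccur (fun i : ZMod n => {ω | ξ (modRep n i.val) ω = 1}) (progression m)
        (modProgressions n m) ⊆ {ω | longestModAP n (fun i => ξ i ω) < m} ∪
      {ω | ∃ f ∈ F, ω ∈ allOccur (fun i : ZMod n => {ω | ξ (modRep n i.val) ω = 1})
        (progression m f)} := by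
    intro ω hω
    by_cases hlt : longestModAP n (fun i => ξ i ω) < m
    · exact .inl hlt
    · obtain ⟨f, hf, h1⟩ := (le_longestModAP_iff_zmod (by omega)).1 (not_lt.1 hlt)
      by_cases hs : f.2 ∈ smallOrder n m
      · exact .inr ⟨f, by simp [F, hf, hs], mem_allOccur.2 h1⟩
      · obtain ⟨g, hg, e⟩ := exists_modDifferences_progression_eq hm hs
        refine absurd ?_ (mem_noneOccur.1 hω g (mem_modProgressions.2 hg))
        rw [e]
        exact mem_allOccur.2 h1
  refine (measureReal_mono hsub).trans ((measureReal_union_le _ _).trans ?_)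
  refine add_le_add_right ?_ _
  refine ((isBernoulliFamily_zmod h).real_exists_allOccur_le _
    fun f hf => Finset.subset_univ _).trans ?_
  have h1 : ∀ f ∈ F, p ^ (progression m f).card ≤ p ^ m := fun f hf => by
    rw [card_progression_of_le_addOrderOf (by simp [F] at hf; exact hf.1)]
  refine (Finset.sum_le_card_nsmul _ _ _ h1).trans ?_
  rw [nsmul_eq_mul]
  refine mul_le_mul_of_nonneg_right ?_ (pow_nonneg hp _)
  have : F.card ≤ n * m ^ 4 := by
    refine (Finset.card_le_card (t := Finset.univ ×ˢ smallOrder n m) fun f hf => ?_).trans ?_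
    · simp [F] at hf
      simp [hf.2]
    · rw [Finset.card_product, Finset.card_univ, ZMod.card]
      exact Nat.mul_le_mul_left _ card_smallOrder_le
  exact_mod_cast this

theorem measurableSet_longestModAP_lt
    (h : IsBernoulliFamily P (Finset.Icc 1 n) (fun i => {ω | ξ i ω = 1}) p) (hm : 1 ≤ m) :
    MeasurableSet {ω | longestModAP n (fun i => ξ i ω) < m} := by
  have e : {ω | longestModAP n (fun i => ξ i ω) < m} =
      noneOccur (fun i : ZMod n => {ω | ξ (modRep n i.val) ω = 1}) (progression m)
        (Finset.univ.filter fun f => m ≤ addOrderOf f.2) := by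
    ext ω
    rw [Set.mem_ofPred_eq, ← not_le, le_longestModAP_iff_zmod hm, mem_noneOccur]
    simp only [mem_allOccur, Finset.mem_filter, Finset.mem_univ, true_and, Set.mem_ofPred_eq]
    push Not
    rfl
  rw [e]
  exact (isBernoulliFamily_zmod h).measurableSet_noneOccur fun f _ => Finset.subset_univ _

theorem abs_real_longestModAP_lt_sub_le [IsProbabilityMeasure P]
    (h : IsBernoulliFamily P (Finset.Icc 1 n) (fun i => {ω | ξ i ω = 1}) p) (hp : 0 ≤ p)
    (hp2 : p ≤ 1 / 2) (hm : 2 ≤ m) :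
    |P.real {ω | longestModAP n (fun i => ξ i ω) < m} -
        (1 - p ^ m) ^ (modProgressions n m).card| ≤
      (modProgressions n m).card * (2 * (m ^ 2 * n * p ^ (2 * m - 1)) +
        m ^ 5 * p ^ (2 * m - (m + 1) / 2) + 4 * p ^ (m + 1)) + n * m ^ 4 * p ^ m := by
  have key := (isBernoulliFamily_zmod h).abs_real_noneOccur_progression_sub_le hp hp2
    (goodDifferences_zmod (n := n) (m := m) (by omega)) (F := modProgressions n m)
    (fun f hf => mem_modProgressions.1 hf) fun f hf => Finset.subset_univ _
  have h1 := real_noneOccur_modProgressions_le h hp hm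
  have h2 := measureReal_mono (μ := P) (setOf_longestModAP_lt_subset (n := n) (m := m) (ξ := ξ)
    (by omega))
  have hS : ((modDifferences n m).card : ℝ) ≤ n := by
    have := card_modDifferences_le (n := n) (m := m)
    have h0 := NeZero.pos n
    exact_mod_cast this.trans (by omega)
  have h3 : ((modProgressions n m).card : ℝ) * (2 * (m ^ 2 * (modDifferences n m).card *
        p ^ (2 * m - 1)) + m ^ 5 * p ^ (2 * m - (m + 1) / 2) + 4 * p ^ (m + 1)) ≤
      (modProgressions n m).card * (2 * (m ^ 2 * n * p ^ (2 * m - 1)) +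
        m ^ 5 * p ^ (2 * m - (m + 1) / 2) + 4 * p ^ (m + 1)) := by gcongr
  have h4 : 0 ≤ n * m ^ 4 * p ^ m := by positivity
  rw [abs_le] at key ⊢
  constructor <;> linarith [key.1, key.2]

theorem real_longestModAP_lt_le [IsProbabilityMeasure P]
    (h : IsBernoulliFamily P (Finset.Icc 1 n) (fun i => {ω | ξ i ω = 1}) p) (hp : 0 < p)
    (hp2 : p ≤ 1 / 2) (hm : 2 ≤ m) (hmn : 4 * m ^ 4 ≤ n) :
    P.real {ω | longestModAP n (fun i => ξ i ω) < m} ≤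
      4 * m ^ 3 / (n * p) + 4 * m ^ 6 / (n ^ 2 * p ^ ((m + 1) / 2)) +
        20 / (n ^ 2 * p ^ m) := by
  have hn0 := NeZero.pos n
  have hn : (0 : ℝ) < n := by exact_mod_cast hn0
  have hS : ((modDifferences n m).card : ℝ) ≤ n := by
    exact_mod_cast card_modDifferences_le.trans (by omega)
  have hN : (n : ℝ) ^ 2 / 4 ≤ (modProgressions n m).card := by
    -- Of about n/2 candidates, at most m⁴ ≤ n/4 have small order.
    have h1 : n ≤ 4 * (modDifferences n m).card := by
      have := le_card_modDifferences (n := n) (m := m)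
      omega
    have h2 : (n : ℝ) ≤ 4 * (modDifferences n m).card := by exact_mod_cast h1
    rw [card_modProgressions]; push_cast; nlinarith
  have hm1 : (1 : ℝ) ≤ m := by exact_mod_cast (by omega : 1 ≤ m)
  have hN0 : (0 : ℝ) < (n : ℝ) ^ 2 / 4 := by positivity
  have key := (isBernoulliFamily_zmod h).real_noneOccur_progression_le hp hp2 (by omega)
    (goodDifferences_zmod (n := n) (m := m) (by omega)) (F := modProgressions n m)
    (fun f hf => mem_modProgressions.1 hf) (fun f hf => Finset.subset_univ _)
    (by exact_mod_cast hN0.trans_le hN)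
  refine (measureReal_mono (setOf_longestModAP_lt_subset (by omega))).trans (key.trans ?_)
  -- The powers m² and m⁵ are weakened to m³ and m⁶, so that the limit lemmas serve both kinds of
  -- progression.
  refine add_le_add (add_le_add ?_ ?_) ?_
  · calc (m : ℝ) ^ 2 * (modDifferences n m).card / ((modProgressions n m).card * p) ≤
          m ^ 2 * n / (n ^ 2 / 4 * p) := by gcongr
      _ = 4 * m ^ 2 / (n * p) := by field_simp
      _ ≤ _ := by gcongr; norm_num
  · calc (m : ℝ) ^ 5 / ((modProgressions n m).card * p ^ ((m + 1) / 2)) ≤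
          m ^ 5 / (n ^ 2 / 4 * p ^ ((m + 1) / 2)) := by gcongr
      _ = 4 * m ^ 5 / (n ^ 2 * p ^ ((m + 1) / 2)) := by field_simp
      _ ≤ _ := by gcongr; norm_num
  · calc (5 : ℝ) / ((modProgressions n m).card * p ^ m) ≤ 5 / (n ^ 2 / 4 * p ^ m) := by gcongr
      _ = _ := by field_simp; norm_num

end Mod

end RowBounds

/-! ### Limits for fixed length, and the laws when b is finite. -/

section Asymptotics

/-- Take logarithms and squeeze: -Nx/(1-x) ≤ N log(1-x) ≤ -Nx. -/
theorem tendsto_one_sub_pow_exp {x : ℕ → ℝ} {N : ℕ → ℕ} {c : ℝ} (hx : Tendsto x atTop (𝓝 0))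
    (hN : Tendsto (fun n => N n * x n) atTop (𝓝 c)) :
    Tendsto (fun n => (1 - x n) ^ N n) atTop (𝓝 (Real.exp (-c))) := by
  have h1 : ∀ᶠ n in atTop, x n < 1 := hx.eventually_lt_const (by norm_num)
  have hlog : Tendsto (fun n => N n * Real.log (1 - x n)) atTop (𝓝 (-c)) := by
    have hl : Tendsto (fun n => -(N n * x n) / (1 - x n)) atTop (𝓝 (-c)) := by
      have := hN.neg.div (tendsto_const_nhds.sub hx : Tendsto (fun n => 1 - x n) atTop (𝓝 (1 - 0)))
        (by norm_num)
      rwa [sub_zero, div_one] at this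
    refine tendsto_of_tendsto_of_tendsto_of_le_of_le' hl hN.neg ?_ ?_
    · filter_upwards [h1] with n hn
      have h0 : 0 < 1 - x n := by linarith
      have := Real.one_sub_inv_le_log_of_pos h0
      have e : 1 - (1 - x n)⁻¹ = -x n / (1 - x n) := by field_simp; ring
      rw [e] at this
      calc -(N n * x n) / (1 - x n) = N n * (-x n / (1 - x n)) := by ring
        _ ≤ _ := by gcongr
    · filter_upwards [h1] with n hn
      have := Real.log_le_sub_one_of_pos (show 0 < 1 - x n by linarith)
      calc N n * Real.log (1 - x n) ≤ N n * (1 - x n - 1) := by gcongr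
        _ = _ := by ring
  refine ((Real.continuous_exp.tendsto _).comp hlog).congr' ?_
  filter_upwards [h1] with n hn
  rw [Function.comp_apply, mul_comm, Real.exp_mul, Real.exp_log (by linarith), Real.rpow_natCast]

variable {p : ℕ → ℝ}

theorem eventually_pos_of_tendsto_mul_atTop
    (hnp : Tendsto (fun n : ℕ => (n : ℝ) * p n) atTop atTop) : ∀ᶠ n in atTop, 0 < p n := by
  filter_upwards [hnp.eventually_gt_atTop 0] with n hn
  exact pos_of_mul_pos_right hn (Nat.cast_nonneg n)

theorem tendsto_neg_log_atTop (hp_zero : Tendsto p atTop (𝓝 0))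
    (hnp : Tendsto (fun n : ℕ => (n : ℝ) * p n) atTop atTop) :
    Tendsto (fun n => -Real.log (p n)) atTop atTop := by
  refine tendsto_neg_atBot_atTop.comp (Real.tendsto_log_nhdsGT_zero.comp ?_)
  exact tendsto_nhdsWithin_iff.2 ⟨hp_zero, eventually_pos_of_tendsto_mul_atTop hnp⟩

theorem pow_eq_exp_neg {x : ℝ} (hx : 0 < x) (m : ℕ) :
    x ^ m = Real.exp (-(-Real.log x * m)) := by
  rw [neg_mul, neg_neg, Real.exp_mul, Real.exp_log hx, Real.rpow_natCast]

theorem sq_mul_pow_eq_exp {n m : ℕ} {x : ℝ} (hn : 0 < n) (hx : 0 < x) :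
    (n : ℝ) ^ 2 * x ^ m = Real.exp (2 * Real.log n - -Real.log x * m) := by
  have hn' : (0 : ℝ) < n := by exact_mod_cast hn
  rw [pow_eq_exp_neg hx, sub_eq_add_neg, Real.exp_add]
  congr 1
  rw [mul_comm, Real.exp_mul, Real.exp_log hn']
  norm_cast

/-- With L = -log p → ∞, n² p^m = exp(2 log n - Lm) ≥ exp(L(c - m)). The fixed gap c - m > 0 is
amplified by L; `tendsto_sq_mul_pow_zero` is the mirror image. -/
theorem tendsto_sq_mul_pow_atTop (hp_zero : Tendsto p atTop (𝓝 0))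
    (hnp : Tendsto (fun n : ℕ => (n : ℝ) * p n) atTop atTop) {m : ℕ} {c : ℝ} (hc : m < c)
    (h : ∀ᶠ n : ℕ in atTop, c < 2 * Real.log n / (-Real.log (p n))) :
    Tendsto (fun n : ℕ => (n : ℝ) ^ 2 * p n ^ m) atTop atTop := by
  have hL := tendsto_neg_log_atTop hp_zero hnp
  have h1 : Tendsto (fun n => Real.exp (-Real.log (p n) * (c - m))) atTop atTop :=
    Real.tendsto_exp_atTop.comp (hL.atTop_mul_const (by linarith))
  refine tendsto_atTop_mono' _ ?_ h1
  filter_upwards [h, hL.eventually_gt_atTop 0, eventually_pos_of_tendsto_mul_atTop hnp,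
    eventually_gt_atTop 0] with n h hL hp hn
  rw [sq_mul_pow_eq_exp hn hp]
  rw [lt_div_iff₀ hL] at h
  exact Real.exp_le_exp.2 (by linarith)

theorem tendsto_sq_mul_pow_zero (hp_zero : Tendsto p atTop (𝓝 0))
    (hnp : Tendsto (fun n : ℕ => (n : ℝ) * p n) atTop atTop) {m : ℕ} {c : ℝ} (hc : c < m)
    (h : ∀ᶠ n : ℕ in atTop, 2 * Real.log n / (-Real.log (p n)) < c) :
    Tendsto (fun n : ℕ => (n : ℝ) ^ 2 * p n ^ m) atTop (𝓝 0) := by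
  have hL := tendsto_neg_log_atTop hp_zero hnp
  have h1 : Tendsto (fun n => Real.exp (-Real.log (p n) * (c - m))) atTop (𝓝 0) :=
    Real.tendsto_exp_atBot.comp (hL.atTop_mul_const_of_neg (by linarith))
  have hp := eventually_pos_of_tendsto_mul_atTop hnp
  refine tendsto_of_tendsto_of_tendsto_of_le_of_le' tendsto_const_nhds h1 ?_ ?_
  · filter_upwards [hp] with n hp
    positivity
  filter_upwards [h, hL.eventually_gt_atTop 0, hp, eventually_gt_atTop 0] with n h hL hp hn
  rw [sq_mul_pow_eq_exp hn hp]
  rw [div_lt_iff₀ hL] at h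
  exact Real.exp_le_exp.2 (by linarith)

/-- The limit of a probability that satisfies the local dependence bound. -/
theorem tendsto_exp_of_abs_sub_le (hp0 : ∀ n, 0 ≤ p n) (hp_zero : Tendsto p atTop (𝓝 0))
    (hnp : Tendsto (fun n : ℕ => (n : ℝ) * p n) atTop atTop) {m : ℕ} (hm : 2 ≤ m) {u c K : ℝ}
    (hu : Tendsto (fun n : ℕ => (n : ℝ) ^ 2 * p n ^ m) atTop (𝓝 u)) {q : ℕ → ℝ} {N : ℕ → ℕ}
    (hN : ∀ᶠ n : ℕ in atTop, |(N n : ℝ) - c * n ^ 2| ≤ K * n)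
    (hq : ∀ᶠ n : ℕ in atTop, |q n - (1 - p n ^ m) ^ N n| ≤
      N n * (2 * (m ^ 2 * n * p n ^ (2 * m - 1)) + m ^ 5 * p n ^ (2 * m - (m + 1) / 2) +
        4 * p n ^ (m + 1)) + n * m ^ 4 * p n ^ m) :
    Tendsto q atTop (𝓝 (Real.exp (-(c * u)))) := by
  have hpm : Tendsto (fun n => p n ^ m) atTop (𝓝 0) := by
    simpa [zero_pow (by omega : m ≠ 0)] using hp_zero.pow m
  have hinv : Tendsto (fun n : ℕ => (n : ℝ)⁻¹) atTop (𝓝 0) :=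
    tendsto_inv_atTop_zero.comp tendsto_natCast_atTop_atTop
  have hnpm : Tendsto (fun n : ℕ => (n : ℝ) * p n ^ m) atTop (𝓝 0) := by
    have := hu.mul hinv
    rw [mul_zero] at this
    refine this.congr' ?_
    filter_upwards [eventually_gt_atTop 0] with n hn
    have : (n : ℝ) ≠ 0 := by exact_mod_cast hn.ne'
    field_simp
  have hNp : Tendsto (fun n => N n * p n ^ m) atTop (𝓝 (c * u)) := by
    have h1 : Tendsto (fun n : ℕ => N n * p n ^ m - c * ((n : ℝ) ^ 2 * p n ^ m)) atTop (𝓝 0) := by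
      refine squeeze_zero_norm' ?_ (by simpa using hnpm.const_mul K :
        Tendsto (fun n : ℕ => K * ((n : ℝ) * p n ^ m)) atTop (𝓝 0))
      filter_upwards [hN] with n hn
      rw [Real.norm_eq_abs, ← mul_assoc, ← sub_mul, abs_mul, abs_of_nonneg (pow_nonneg (hp0 n) m),
        ← mul_assoc]
      exact mul_le_mul_of_nonneg_right hn (pow_nonneg (hp0 n) m)
    simpa using h1.add (hu.const_mul c)
  have hlim := tendsto_one_sub_pow_exp hpm hNp
  have herr : Tendsto (fun n : ℕ => (N n : ℝ) * (2 * (m ^ 2 * n * p n ^ (2 * m - 1)) +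
      m ^ 5 * p n ^ (2 * m - (m + 1) / 2) + 4 * p n ^ (m + 1)) + n * m ^ 4 * p n ^ m)
      atTop (𝓝 0) := by
    -- Pairs with one common point: a bounded quantity over np, so np → ∞ is what removes them.
    have e1 : Tendsto (fun n : ℕ => 2 * (m : ℝ) ^ 2 * (N n * p n ^ m) *
        ((n ^ 2 * p n ^ m) * (n * p n)⁻¹)) atTop (𝓝 0) := by
      have := (hNp.const_mul (2 * (m : ℝ) ^ 2)).mul (hu.mul (tendsto_inv_atTop_zero.comp hnp))
      simpa using this
    -- The remaining exponent m - (m+1)/2 is positive exactly because m ≥ 2.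
    have e2 : Tendsto (fun n : ℕ => (m : ℝ) ^ 5 * (N n * p n ^ m) * p n ^ (m - (m + 1) / 2)) atTop
        (𝓝 0) := by
      have := (hNp.const_mul ((m : ℝ) ^ 5)).mul (hp_zero.pow (m - (m + 1) / 2))
      simpa [zero_pow (by omega : m - (m + 1) / 2 ≠ 0)] using this
    have e3 : Tendsto (fun n : ℕ => 4 * (N n * p n ^ m) * p n) atTop (𝓝 0) := by
      simpa using (hNp.const_mul 4).mul hp_zero
    have e4 : Tendsto (fun n : ℕ => (m : ℝ) ^ 4 * (n * p n ^ m)) atTop (𝓝 0) := by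
      simpa using hnpm.const_mul ((m : ℝ) ^ 4)
    have := ((e1.add e2).add e3).add e4
    simp only [add_zero] at this
    refine this.congr' ?_
    filter_upwards [eventually_gt_atTop 0, eventually_pos_of_tendsto_mul_atTop hnp] with n hn hp
    have hn' : (n : ℝ) ≠ 0 := by exact_mod_cast hn.ne'
    have f1 : p n ^ (2 * m - 1) = p n ^ m * p n ^ m / p n := by
      rw [eq_div_iff hp.ne', ← pow_succ, ← pow_add]; congr 1; omega
    have f2 : p n ^ (2 * m - (m + 1) / 2) = p n ^ m * p n ^ (m - (m + 1) / 2) := by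
      rw [← pow_add]; congr 1; omega
    rw [f1, f2]
    field_simp
    ring
  have hdiff : Tendsto (fun n => q n - (1 - p n ^ m) ^ N n) atTop (𝓝 0) :=
    squeeze_zero_norm' hq herr
  simpa using hdiff.add hlim

/-- The second moment bound tends to zero for progressions of a fixed length. -/
theorem tendsto_secondMoment_zero (hp0 : ∀ n, 0 ≤ p n) (hp1 : ∀ n, p n ≤ 1)
    (hnp : Tendsto (fun n : ℕ => (n : ℝ) * p n) atTop atTop) {m : ℕ} (hm : 1 ≤ m)
    (hu : Tendsto (fun n : ℕ => (n : ℝ) ^ 2 * p n ^ m) atTop atTop) (K : ℝ) :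
    Tendsto (fun n : ℕ => 4 * m ^ 3 / (n * p n) + 4 * m ^ 6 / (n ^ 2 * p n ^ ((m + 1) / 2)) +
        K / (n ^ 2 * p n ^ m)) atTop (𝓝 0) := by
  have h2 : Tendsto (fun n : ℕ => (n : ℝ) ^ 2 * p n ^ ((m + 1) / 2)) atTop atTop := by
    refine tendsto_atTop_mono (fun n => ?_) hu
    exact mul_le_mul_of_nonneg_left (pow_le_pow_of_le_one (hp0 n) (hp1 n) (by omega))
      (by positivity)
  simpa using ((tendsto_const_nhds.div_atTop hnp).add (tendsto_const_nhds.div_atTop h2)).add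
    (tendsto_const_nhds.div_atTop hu)

section Laws

variable {Ω : ℕ → Type*} [∀ n, MeasurableSpace (Ω n)] {P : ∀ n, Measure (Ω n)}

/-- The asymptotic behaviour of `P (X n < m)` for a fixed length `m`, in terms of the limit of
`n ^ 2 * p n ^ m`. -/
structure ThresholdLaw (P : ∀ n, Measure (Ω n)) (p : ℕ → ℝ) (X : ∀ n, Ω n → ℕ) (c : ℕ → ℝ) :
    Prop where
  measurableSet_lt : ∀ m, 1 ≤ m → ∀ᶠ n in atTop, MeasurableSet {ω | X n ω < m}
  tendsto_lt_zero : ∀ m, 2 ≤ m → Tendsto (fun n : ℕ => (n : ℝ) ^ 2 * p n ^ m) atTop atTop →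
    Tendsto (fun n => (P n).real {ω | X n ω < m}) atTop (𝓝 0)
  tendsto_le_zero : ∀ m, 2 ≤ m → Tendsto (fun n : ℕ => (n : ℝ) ^ 2 * p n ^ m) atTop (𝓝 0) →
    Tendsto (fun n => (P n).real {ω | m ≤ X n ω}) atTop (𝓝 0)
  tendsto_lt_exp : ∀ m, 2 ≤ m → ∀ u : ℝ,
    Tendsto (fun n : ℕ => (n : ℝ) ^ 2 * p n ^ m) atTop (𝓝 u) →
    Tendsto (fun n => (P n).real {ω | X n ω < m}) atTop (𝓝 (Real.exp (-(c m * u))))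

variable [∀ n, IsProbabilityMeasure (P n)]

theorem tendsto_measure_of_real {A : ∀ n, Set (Ω n)} {c : ℝ}
    (h : Tendsto (fun n => (P n).real (A n)) atTop (𝓝 c)) :
    Tendsto (fun n => P n (A n)) atTop (𝓝 (ENNReal.ofReal c)) := by
  refine (ENNReal.tendsto_ofReal h).congr fun n => ?_
  exact ofReal_measureReal

/-- Only subadditivity is used, so the sets `A n` need not be measurable. -/
theorem tendsto_measure_window {X : ∀ n, Ω n → ℕ} {m M : ℕ → ℕ}
    (hm : Tendsto (fun n => (P n).real {ω | X n ω < m n}) atTop (𝓝 0))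
    (hM : Tendsto (fun n => (P n).real {ω | M n ≤ X n ω}) atTop (𝓝 0)) {A : ∀ n, Set (Ω n)}
    (hA : ∀ᶠ n in atTop, ∀ ω, m n ≤ X n ω → X n ω < M n → ω ∈ A n) :
    Tendsto (fun n => P n (A n)) atTop (𝓝 1) := by
  rw [← ENNReal.ofReal_one]
  apply tendsto_measure_of_real
  have hl : Tendsto (fun n => 1 - (P n).real {ω | X n ω < m n} - (P n).real {ω | M n ≤ X n ω})
      atTop (𝓝 1) := by
    simpa using (tendsto_const_nhds.sub hm).sub hM
  refine tendsto_of_tendsto_of_tendsto_of_le_of_le' hl tendsto_const_nhds ?_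
    (.of_forall fun n => measureReal_le_one)
  filter_upwards [hA] with n hn
  have hsub : (Set.univ : Set (Ω n)) ⊆ {ω | X n ω < m n} ∪ {ω | M n ≤ X n ω} ∪ A n := by
    intro ω _
    by_cases h1 : X n ω < m n
    · exact .inl (.inl h1)
    by_cases h2 : M n ≤ X n ω
    · exact .inl (.inr h2)
    exact .inr (hn ω (not_lt.1 h1) (not_le.1 h2))
  have h1 := measureReal_mono (μ := P n) hsub
  rw [probReal_univ] at h1
  have h2 := measureReal_union_le (μ := P n) ({ω | X n ω < m n} ∪ {ω | M n ≤ X n ω}) (A n)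
  have h3 := measureReal_union_le (μ := P n) {ω | X n ω < m n} {ω | M n ≤ X n ω}
  linarith

namespace ThresholdLaw

variable {X : ∀ n, Ω n → ℕ} {c : ℕ → ℝ}

/-- The distribution concentrates on `k - 1` and `k`, with the given limiting weights. -/
theorem tendsto_eq (h : ThresholdLaw P p X c) {k : ℕ} (hk : 3 ≤ k)
    (h1 : Tendsto (fun n : ℕ => (n : ℝ) ^ 2 * p n ^ (k - 1)) atTop atTop)
    (h2 : Tendsto (fun n : ℕ => (n : ℝ) ^ 2 * p n ^ (k + 1)) atTop (𝓝 0)) {e : ℝ}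
    (he : Tendsto (fun n => (P n).real {ω | X n ω < k}) atTop (𝓝 e)) :
    Tendsto (fun n => P n {ω | X n ω = k - 1}) atTop (𝓝 (ENNReal.ofReal e)) ∧
      Tendsto (fun n => P n {ω | X n ω = k}) atTop (𝓝 (1 - ENNReal.ofReal e)) := by
  have t1 := h.tendsto_lt_zero (k - 1) (by omega) h1
  have t2 := h.tendsto_le_zero (k + 1) (by omega) h2
  have he0 : 0 ≤ e := ge_of_tendsto' he fun n => measureReal_nonneg
  constructor
  · apply tendsto_measure_of_real
    have hl := he.sub t1
    rw [sub_zero] at hl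
    refine tendsto_of_tendsto_of_tendsto_of_le_of_le hl he (fun n => ?_) fun n => ?_
    · have : {ω | X n ω < k} ⊆ {ω | X n ω < k - 1} ∪ {ω | X n ω = k - 1} := by
        intro ω hω
        simp only [Set.mem_union, Set.mem_ofPred_eq] at hω ⊢
        omega
      have := (measureReal_mono (μ := P n) this).trans (measureReal_union_le _ _)
      simp only
      linarith
    · refine measureReal_mono fun ω hω => ?_
      simp only [Set.mem_ofPred_eq] at hω ⊢
      omega
  · rw [← ENNReal.ofReal_one, ← ENNReal.ofReal_sub _ he0]
    apply tendsto_measure_of_real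
    have hu : Tendsto (fun n => 1 - (P n).real {ω | X n ω < k}) atTop (𝓝 (1 - e)) :=
      tendsto_const_nhds.sub he
    have hl := hu.sub t2
    rw [sub_zero] at hl
    -- An exact complement is needed for the limit of P(X = k); this is what the measurability field
    -- of `ThresholdLaw` is for.
    have hc : ∀ᶠ n in atTop, (P n).real {ω | k ≤ X n ω} = 1 - (P n).real {ω | X n ω < k} := by
      filter_upwards [h.measurableSet_lt k (by omega)] with n hn
      rw [← probReal_compl_eq_one_sub hn]
      congr 1; ext ω; simp
    refine tendsto_of_tendsto_of_tendsto_of_le_of_le' hl hu ?_ ?_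
    · filter_upwards [hc] with n hn
      have : {ω | k ≤ X n ω} ⊆ {ω | k + 1 ≤ X n ω} ∪ {ω | X n ω = k} := by
        intro ω hω
        simp only [Set.mem_union, Set.mem_ofPred_eq] at hω ⊢
        omega
      have := (measureReal_mono (μ := P n) this).trans (measureReal_union_le _ _)
      linarith
    · filter_upwards [hc] with n hn
      rw [← hn]
      refine measureReal_mono fun ω hω => ?_
      simp only [Set.mem_ofPred_eq] at hω ⊢
      omega

/-- For finite u the weight of k - 1 comes from the Poisson-type limit; for u = ∞ it is 0 by the
second moment bound. -/
theorem tendsto_eq_of_tendsto_ereal (h : ThresholdLaw P p X c) (hp0 : ∀ n, 0 ≤ p n) {k : ℕ}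
    (hk : 3 ≤ k) (h1 : Tendsto (fun n : ℕ => (n : ℝ) ^ 2 * p n ^ (k - 1)) atTop atTop)
    (h2 : Tendsto (fun n : ℕ => (n : ℝ) ^ 2 * p n ^ (k + 1)) atTop (𝓝 0)) {d : ℝ} (hd : 0 < d)
    (hc : c k = 1 / d) {u : EReal}
    (hu : Tendsto (fun n : ℕ => (((n : ℝ) ^ 2 * p n ^ k : ℝ) : EReal)) atTop (𝓝 u)) :
    Tendsto (fun n => P n {ω | X n ω = k - 1}) atTop (𝓝 (EReal.exp (-(u / (d : EReal))))) ∧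
      Tendsto (fun n => P n {ω | X n ω = k}) atTop (𝓝 (1 - EReal.exp (-(u / (d : EReal))))) := by
  have hu0 : 0 ≤ u := ge_of_tendsto' hu fun n => by
    have := hp0 n
    exact_mod_cast (by positivity : (0 : ℝ) ≤ (n : ℝ) ^ 2 * p n ^ k)
  induction u with
  | bot => simp at hu0
  | top =>
    have ht := h.tendsto_lt_zero k (by omega) (EReal.tendsto_coe_nhds_top_iff.1 hu)
    rw [EReal.top_div_of_pos_ne_top (by exact_mod_cast hd) (EReal.coe_ne_top d), EReal.neg_top,
      EReal.exp_bot, ← ENNReal.ofReal_zero]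
    exact h.tendsto_eq hk h1 h2 ht
  | coe u =>
    have ht := h.tendsto_lt_exp k (by omega) u (EReal.tendsto_coe.1 hu)
    rw [← EReal.coe_div, ← EReal.coe_neg, EReal.exp_coe,
      show -(u / d) = -(c k * u) by rw [hc]; ring]
    exact h.tendsto_eq hk h1 h2 ht

end ThresholdLaw

variable {ξ : ∀ n, ℕ → Ω n → ℕ}

theorem thresholdLaw_longestAP
    (hB : ∀ n, IsBernoulliFamily (P n) (Finset.Icc 1 n) (fun i => {ω | ξ n i ω = 1}) (p n))
    (hp0 : ∀ n, 0 ≤ p n) (hp1 : ∀ n, p n ≤ 1) (hp_zero : Tendsto p atTop (𝓝 0))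
    (hnp : Tendsto (fun n : ℕ => (n : ℝ) * p n) atTop atTop) :
    ThresholdLaw P p (fun n ω => longestAP n fun i => ξ n i ω)
      (fun m => 1 / (2 * ((m : ℝ) - 1))) where
  measurableSet_lt m hm := .of_forall fun n => measurableSet_longestAP_lt (hB n) hm
  tendsto_lt_zero m hm hu := by
    refine squeeze_zero' (.of_forall fun n => measureReal_nonneg) ?_
      (tendsto_secondMoment_zero hp0 hp1 hnp (by omega) hu (20 * m))
    filter_upwards [eventually_pos_of_tendsto_mul_atTop hnp,
      hp_zero.eventually_le_const (show (0 : ℝ) < 1 / 2 by norm_num),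
      eventually_ge_atTop (4 * m)] with n h1 h2 h3
    exact real_longestAP_lt_le (hB n) h1 h2 hm h3
  tendsto_le_zero m hm hu := by
    refine squeeze_zero (fun n => measureReal_nonneg) (fun n => ?_) hu
    refine (real_le_longestAP_le (hB n) (by omega)).trans ?_
    refine mul_le_mul_of_nonneg_right ?_ (pow_nonneg (hp0 n) m)
    obtain ⟨d, rfl⟩ : ∃ d, m = d + 1 := ⟨m - 1, by omega⟩
    refine (card_intProgressions_le (by omega)).trans (div_le_self (by positivity) ?_)
    have : (1 : ℝ) ≤ d := by exact_mod_cast (by omega : 1 ≤ d)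
    linarith
  tendsto_lt_exp m hm u hu := by
    refine tendsto_exp_of_abs_sub_le hp0 hp_zero hnp hm hu (K := 1)
      (N := fun n => (intProgressions n m).card) ?_ ?_
    · filter_upwards [eventually_ge_atTop m] with n hn
      obtain ⟨d, rfl⟩ : ∃ d, m = d + 1 := ⟨m - 1, by omega⟩
      have h1 := card_intProgressions_le (n := n) (show 1 ≤ d by omega)
      have h2 := le_card_intProgressions (n := n) (show 1 ≤ d by omega) (by omega)
      have e : 1 / (2 * (((d + 1 : ℕ) : ℝ) - 1)) * (n : ℝ) ^ 2 = n ^ 2 / (2 * d) := by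
        push_cast; rw [add_sub_cancel_right]; ring
      rw [e, abs_le]
      constructor <;> linarith [(Nat.cast_nonneg n : (0 : ℝ) ≤ n)]
    · filter_upwards [hp_zero.eventually_le_const (show (0 : ℝ) < 1 / 2 by norm_num)] with n h2
      have := hp0 n
      exact (abs_real_longestAP_lt_sub_le (hB n) (hp0 n) h2 (by omega)).trans
        (le_add_of_nonneg_right (by positivity))

theorem thresholdLaw_longestModAP
    (hB : ∀ n, IsBernoulliFamily (P n) (Finset.Icc 1 n) (fun i => {ω | ξ n i ω = 1}) (p n))
    (hp0 : ∀ n, 0 ≤ p n) (hp1 : ∀ n, p n ≤ 1) (hp_zero : Tendsto p atTop (𝓝 0))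
    (hnp : Tendsto (fun n : ℕ => (n : ℝ) * p n) atTop atTop) :
    ThresholdLaw P p (fun n ω => longestModAP n fun i => ξ n i ω) (fun _ => 1 / 2) where
  measurableSet_lt m hm := by
    filter_upwards [eventually_gt_atTop 0] with n hn
    have : NeZero n := ⟨hn.ne'⟩
    exact measurableSet_longestModAP_lt (hB n) hm
  tendsto_lt_zero m hm hu := by
    refine squeeze_zero' (.of_forall fun n => measureReal_nonneg) ?_
      (tendsto_secondMoment_zero hp0 hp1 hnp (by omega) hu 20)
    filter_upwards [eventually_pos_of_tendsto_mul_atTop hnp,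
      hp_zero.eventually_le_const (show (0 : ℝ) < 1 / 2 by norm_num),
      eventually_ge_atTop (4 * m ^ 4), eventually_gt_atTop 0] with n h1 h2 h3 hn
    have : NeZero n := ⟨hn.ne'⟩
    exact real_longestModAP_lt_le (hB n) h1 h2 hm h3
  tendsto_le_zero m hm hu := by
    refine squeeze_zero' (.of_forall fun n => measureReal_nonneg) ?_ hu
    filter_upwards [eventually_gt_atTop 0] with n hn
    have : NeZero n := ⟨hn.ne'⟩
    exact real_le_longestModAP_le (hB n) (hp0 n) (by omega)
  tendsto_lt_exp m hm u hu := by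
    refine tendsto_exp_of_abs_sub_le hp0 hp_zero hnp hm hu (K := m ^ 4 + 1)
      -- `modProgressions` needs n ≠ 0; the value at 0 is irrelevant to the limit.
      (N := fun n => if h : n = 0 then 0 else
        have : NeZero n := ⟨h⟩
        (modProgressions n m).card) ?_ ?_
    · filter_upwards [eventually_gt_atTop 0] with n hn
      have : NeZero n := ⟨hn.ne'⟩
      rw [dif_neg hn.ne', card_modProgressions]
      have h1 := card_modDifferences_le (n := n) (m := m)
      have h2 := le_card_modDifferences (n := n) (m := m)
      have h1' : 2 * ((modDifferences n m).card : ℝ) ≤ n + 1 := by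
        exact_mod_cast (by omega : 2 * (modDifferences n m).card ≤ n + 1)
      have h2' : (n : ℝ) ≤ 2 * ((modDifferences n m).card + (m : ℝ) ^ 4) := by
        exact_mod_cast (by omega : n ≤ 2 * ((modDifferences n m).card + m ^ 4))
      have hn0 : (0 : ℝ) ≤ n := Nat.cast_nonneg n
      have e : ((n * (modDifferences n m).card : ℕ) : ℝ) - 1 / 2 * n ^ 2 =
          ((modDifferences n m).card - n / 2) * n := by push_cast; ring
      rw [e, abs_mul, abs_of_nonneg hn0]
      refine mul_le_mul_of_nonneg_right ?_ hn0
      have : (0 : ℝ) ≤ (m : ℝ) ^ 4 := by positivity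
      rw [abs_le]
      constructor <;> linarith
    · filter_upwards [hp_zero.eventually_le_const (show (0 : ℝ) < 1 / 2 by norm_num),
        eventually_gt_atTop 0] with n h2 hn
      have : NeZero n := ⟨hn.ne'⟩
      rw [dif_neg hn.ne']
      exact abs_real_longestModAP_lt_sub_le (hB n) (hp0 n) h2 hm

end Laws

end Asymptotics

/-! ### Growing lengths when b = ∞, and concentration at ⌊b⌋. -/

section Growing

variable {p : ℕ → ℝ}

theorem tendsto_log_natCast_atTop : Tendsto (fun n : ℕ => Real.log n) atTop atTop :=
  Real.tendsto_log_atTop.comp tendsto_natCast_atTop_atTop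

theorem natCast_mul_eq_exp {n : ℕ} {x : ℝ} (hn : 0 < n) (hx : 0 < x) :
    (n : ℝ) * x = Real.exp (Real.log n - -Real.log x) := by
  rw [sub_neg_eq_add, Real.exp_add, Real.exp_log (by exact_mod_cast hn), Real.exp_log hx]

theorem eventually_neg_log_mul_le
    (hb : Tendsto (fun n : ℕ => 2 * Real.log n / (-Real.log (p n))) atTop atTop)
    (hL : Tendsto (fun n => -Real.log (p n)) atTop atTop) (c : ℝ) :
    ∀ᶠ n : ℕ in atTop, c * -Real.log (p n) ≤ 2 * Real.log n := by
  filter_upwards [hb.eventually_ge_atTop c, hL.eventually_gt_atTop 0] with n h1 h2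
  rwa [le_div_iff₀ h2] at h1

theorem eventually_pow_le_of_mul_le {m : ℕ → ℕ}
    (hL : Tendsto (fun n => -Real.log (p n)) atTop atTop)
    (hm : ∀ᶠ n : ℕ in atTop, -Real.log (p n) * m n ≤ 2 * Real.log n) :
    ∀ᶠ n : ℕ in atTop, 4 * m n ^ 4 ≤ n := by
  -- Once -log p ≥ 1, m ≤ 2 log n, and 64 (log n)⁴ = 4 (2 log n)⁴.
  have h1 : Tendsto (fun n : ℕ => 64 * (Real.log n ^ 4 * Real.exp (-Real.log n))) atTop (𝓝 0) := by
    simpa using ((Real.tendsto_pow_mul_exp_neg_atTop_nhds_zero 4).comp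
      tendsto_log_natCast_atTop).const_mul 64
  filter_upwards [hm, hL.eventually_ge_atTop 1, h1.eventually_le_const one_pos,
    eventually_gt_atTop 0] with n h1 h2 h3 hn
  have hn' : (0 : ℝ) < n := by exact_mod_cast hn
  have hm0 : (0 : ℝ) ≤ m n := Nat.cast_nonneg _
  have h4 : (m n : ℝ) ≤ 2 * Real.log n := by nlinarith
  have h5 : (m n : ℝ) ^ 4 ≤ (2 * Real.log n) ^ 4 := pow_le_pow_left₀ hm0 h4 4
  rw [Real.exp_neg, Real.exp_log hn', ← mul_assoc, ← div_eq_mul_inv, div_le_one hn'] at h3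
  have : (4 : ℝ) * m n ^ 4 ≤ n := by nlinarith
  exact_mod_cast this

/-- The part of the second moment bound caused by overlapping progressions is negligible for
slowly decreasing `p n`. -/
theorem tendsto_overlap_zero {m : ℕ → ℕ}
    (hnp : Tendsto (fun n : ℕ => (n : ℝ) * p n) atTop atTop)
    (hb : Tendsto (fun n : ℕ => 2 * Real.log n / (-Real.log (p n))) atTop atTop)
    (hL : Tendsto (fun n => -Real.log (p n)) atTop atTop)
    (hm : ∀ᶠ n : ℕ in atTop, -Real.log (p n) * m n ≤ 2 * Real.log n) :
    Tendsto (fun n : ℕ => 4 * (m n : ℝ) ^ 3 / (n * p n) +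
      4 * (m n : ℝ) ^ 6 / (n ^ 2 * p n ^ ((m n + 1) / 2))) atTop (𝓝 0) := by
  -- 288 = 32 + 256 collects the numerators `b1` and `b2`; 64 rescales log n to (log n)/2.
  have h0 : Tendsto (fun n : ℕ => 288 * 64 * ((Real.log n / 2) ^ 6 * Real.exp (-(Real.log n / 2))))
      atTop (𝓝 0) := by
    have h2 : Tendsto (fun n : ℕ => Real.log n / 2) atTop atTop :=
      tendsto_log_natCast_atTop.atTop_div_const (by norm_num)
    simpa using ((Real.tendsto_pow_mul_exp_neg_atTop_nhds_zero 6).comp h2).const_mul (288 * 64)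
  have hp := eventually_pos_of_tendsto_mul_atTop hnp
  refine squeeze_zero' ?_ ?_ h0
  · filter_upwards [hp] with n hp
    positivity
  filter_upwards [hp, hm, hL.eventually_ge_atTop 1, eventually_neg_log_mul_le hb hL 4,
    eventually_gt_atTop 0, tendsto_log_natCast_atTop.eventually_ge_atTop 1]
    with n hp h1 h2 h3 hn hl
  have hm0 : (0 : ℝ) ≤ m n := Nat.cast_nonneg _
  have h4 : (m n : ℝ) ≤ 2 * Real.log n := by nlinarith
  -- Both denominators are at least √n: with L = -log p, 4L ≤ 2 log n gives the first, and together
  -- with Lm ≤ 2 log n the second.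
  have e1 : Real.exp (Real.log n / 2) ≤ n * p n := by
    rw [natCast_mul_eq_exp hn hp]
    exact Real.exp_le_exp.2 (by linarith)
  have e2 : Real.exp (Real.log n / 2) ≤ n ^ 2 * p n ^ ((m n + 1) / 2) := by
    rw [sq_mul_pow_eq_exp hn hp]
    apply Real.exp_le_exp.2
    have : (((m n + 1) / 2 : ℕ) : ℝ) ≤ (m n + 1) / 2 := by
      have := Nat.cast_div_le (α := ℝ) (m := m n + 1) (n := 2)
      exact_mod_cast this
    nlinarith
  have b1 : 4 * (m n : ℝ) ^ 3 ≤ 32 * Real.log n ^ 6 := by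
    have a1 : (m n : ℝ) ^ 3 ≤ (2 * Real.log n) ^ 3 := pow_le_pow_left₀ hm0 h4 3
    have a2 : Real.log n ^ 3 ≤ Real.log n ^ 6 := pow_le_pow_right₀ hl (by norm_num)
    nlinarith
  have b2 : 4 * (m n : ℝ) ^ 6 ≤ 256 * Real.log n ^ 6 := by
    have a1 : (m n : ℝ) ^ 6 ≤ (2 * Real.log n) ^ 6 := pow_le_pow_left₀ hm0 h4 6
    nlinarith
  have hl0 : 0 < Real.log n := by linarith
  calc _ ≤ 32 * Real.log n ^ 6 / Real.exp (Real.log n / 2) +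
        256 * Real.log n ^ 6 / Real.exp (Real.log n / 2) := by gcongr
    _ = _ := by rw [Real.exp_neg]; field_simp; ring

variable {Ω : ℕ → Type*} [∀ n, MeasurableSpace (Ω n)] {P : ∀ n, Measure (Ω n)}
  [∀ n, IsProbabilityMeasure (P n)] {ξ : ∀ n, ℕ → Ω n → ℕ}

/-- Put L = -log p and m = ⌊x⌋, where Lx = 2 log n - log log n. Then n² p^m ≥ log n, so the main
second moment term 20m/(n² p^m) is at most 40/L. At length m + 2, n² p^(m+2) ≤ p log n and log n ≤
L(m+1), so the 1/(2(m+1)) in the count leaves at most Lp/2 = L e^(-L)/2. -/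
theorem tendsto_longestAP_window
    (hB : ∀ n, IsBernoulliFamily (P n) (Finset.Icc 1 n) (fun i => {ω | ξ n i ω = 1}) (p n))
    (hp_zero : Tendsto p atTop (𝓝 0))
    (hnp : Tendsto (fun n : ℕ => (n : ℝ) * p n) atTop atTop)
    (hb : Tendsto (fun n : ℕ => 2 * Real.log n / (-Real.log (p n))) atTop atTop) :
    Tendsto (fun n : ℕ => P n {ω | (longestAP n (fun i => ξ n i ω) : ℤ) ∈
      ({⌊2 * Real.log n / (-Real.log (p n)) + Real.log (Real.log n) / Real.log (p n)⌋,
        ⌊2 * Real.log n / (-Real.log (p n)) + Real.log (Real.log n) / Real.log (p n)⌋ + 1} :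
          Set ℤ)}) atTop (𝓝 1) := by
  have hL := tendsto_neg_log_atTop hp_zero hnp
  have hp := eventually_pos_of_tendsto_mul_atTop hnp
  set x : ℕ → ℝ := fun n =>
    2 * Real.log n / (-Real.log (p n)) + Real.log (Real.log n) / Real.log (p n) with hx
  set m : ℕ → ℕ := fun n => ⌊x n⌋.toNat with hmdef
  have hLx : ∀ᶠ n : ℕ in atTop, -Real.log (p n) * x n = 2 * Real.log n - Real.log (Real.log n) := by
    filter_upwards [hL.eventually_gt_atTop 0] with n h
    have : Real.log (p n) ≠ 0 := by linarith
    simp only [hx]; field_simp; ring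
  have hloglog : ∀ᶠ n : ℕ in atTop,
      0 ≤ Real.log (Real.log n) ∧ Real.log (Real.log n) ≤ Real.log n := by
    filter_upwards [tendsto_log_natCast_atTop.eventually_ge_atTop 1] with n hn
    exact ⟨Real.log_nonneg hn, by linarith [Real.log_le_sub_one_of_pos (by linarith :
      0 < Real.log n)]⟩
  -- Lx ≥ log n ≥ 2L, by log log n ≤ log n and the bound 4L ≤ 2 log n.
  have hx2 : ∀ᶠ n in atTop, 2 ≤ x n := by
    filter_upwards [hLx, hloglog, hL.eventually_gt_atTop 0, eventually_neg_log_mul_le hb hL 4]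
      with n h1 h2 h3 h4
    nlinarith
  have hfloor : ∀ᶠ n in atTop, 2 ≤ m n ∧ (m n : ℤ) = ⌊x n⌋ := by
    filter_upwards [hx2] with n h
    have : (2 : ℤ) ≤ ⌊x n⌋ := Int.le_floor.2 (by exact_mod_cast h)
    simp only [hmdef]
    omega
  have hmle : ∀ᶠ n in atTop, (m n : ℝ) ≤ x n ∧ x n < m n + 1 := by
    filter_upwards [hfloor] with n h
    have : (m n : ℝ) = ⌊x n⌋ := by exact_mod_cast h.2
    rw [this]
    exact ⟨Int.floor_le _, Int.lt_floor_add_one _⟩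
  have hmL : ∀ᶠ n : ℕ in atTop, -Real.log (p n) * m n ≤ 2 * Real.log n := by
    filter_upwards [hmle, hLx, hloglog, hL.eventually_gt_atTop 0] with n h1 h2 h3 h4
    nlinarith
  refine tendsto_measure_window (X := fun n ω => longestAP n fun i => ξ n i ω) (m := m)
    (M := fun n => m n + 2) ?_ ?_ ?_
  · have h3 : Tendsto (fun n => 40 / (-Real.log (p n))) atTop (𝓝 0) :=
      tendsto_const_nhds.div_atTop hL
    have hlim := (tendsto_overlap_zero hnp hb hL hmL).add h3
    rw [add_zero] at hlim
    refine squeeze_zero' (.of_forall fun n => measureReal_nonneg) ?_ hlim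
    filter_upwards [hp, hp_zero.eventually_le_const (show (0 : ℝ) < 1 / 2 by norm_num), hfloor,
      eventually_pow_le_of_mul_le hL hmL, hmle, hLx, hmL, hL.eventually_gt_atTop 0,
      eventually_gt_atTop 0, tendsto_log_natCast_atTop.eventually_gt_atTop 0]
      with n h1 h2 h3 h4 h5 h6 h7 h8 h9 h10
    have h4' : 4 * m n ≤ n := (Nat.mul_le_mul_left 4 (Nat.le_self_pow (by norm_num) _)).trans h4
    refine (real_longestAP_lt_le (hB n) h1 h2 h3.1 h4').trans (add_le_add_right ?_ _)
    have h11 : Real.log n ≤ n ^ 2 * p n ^ m n := by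
      rw [sq_mul_pow_eq_exp h9 h1]
      calc Real.log n = Real.exp (Real.log (Real.log n)) := (Real.exp_log h10).symm
        _ ≤ _ := Real.exp_le_exp.2 (by nlinarith)
    calc 20 * (m n : ℝ) / (n ^ 2 * p n ^ m n) ≤ 20 * m n / Real.log n := by gcongr
      _ ≤ _ := by
        rw [div_le_div_iff₀ h10 h8]; linarith
  · have h3 : Tendsto (fun n => -Real.log (p n) * Real.exp (-(-Real.log (p n)))) atTop (𝓝 0) := by
      simpa only [pow_one, Function.comp_def] using
        (Real.tendsto_pow_mul_exp_neg_atTop_nhds_zero 1).comp hL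
    refine squeeze_zero' (.of_forall fun n => measureReal_nonneg) ?_ h3
    filter_upwards [hp, hmle, hLx, hloglog, hL.eventually_gt_atTop 0,
      eventually_gt_atTop 0, tendsto_log_natCast_atTop.eventually_gt_atTop 0]
      with n h1 h5 h6 h7 h8 h9 h10
    refine (real_le_longestAP_le (hB n) (by omega)).trans ?_
    have h12 : (n : ℝ) ^ 2 * p n ^ (m n + 2) ≤ Real.log n * Real.exp (-(-Real.log (p n))) := by
      rw [sq_mul_pow_eq_exp h9 h1]
      nth_rewrite 2 [← Real.exp_log h10]
      rw [← Real.exp_add]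
      apply Real.exp_le_exp.2
      push_cast
      nlinarith
    have h13 : Real.log n ≤ -Real.log (p n) * ((m n + 1 : ℕ) : ℝ) := by
      push_cast; nlinarith
    have h14 : (0 : ℝ) < ((m n + 1 : ℕ) : ℝ) := by positivity
    calc ((intProgressions n (m n + 2)).card : ℝ) * p n ^ (m n + 2)
        ≤ n ^ 2 / (2 * ((m n + 1 : ℕ) : ℝ)) * p n ^ (m n + 2) := by
          gcongr
          exact card_intProgressions_le (d := m n + 1) (by omega)
      _ = (n ^ 2 * p n ^ (m n + 2)) / (2 * ((m n + 1 : ℕ) : ℝ)) := by ring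
      _ ≤ (-Real.log (p n) * ((m n + 1 : ℕ) : ℝ) * Real.exp (-(-Real.log (p n)))) /
          (2 * ((m n + 1 : ℕ) : ℝ)) :=
          div_le_div_of_nonneg_right
            (h12.trans (mul_le_mul_of_nonneg_right h13 (Real.exp_nonneg _))) (by positivity)
      _ = -Real.log (p n) * Real.exp (-(-Real.log (p n))) / 2 := by field_simp
      _ ≤ _ := half_le_self (by positivity)
  · filter_upwards [hfloor] with n h ω h1 h2
    simp only [Set.mem_insert_iff, Set.mem_singleton_iff]
    change _ = ⌊x n⌋ ∨ _ = ⌊x n⌋ + 1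
    omega

/-- With R = ⌊2 log n / (-log p)⌋, n² p^(R-1) ≥ 1/p → ∞ and n² p^(R+2) ≤ p → 0. At lengths R and R +
1 the rounding may leave n² p^m of order one, so a full step is given up on each side. -/
theorem tendsto_longestModAP_window
    (hB : ∀ n, IsBernoulliFamily (P n) (Finset.Icc 1 n) (fun i => {ω | ξ n i ω = 1}) (p n))
    (hp_zero : Tendsto p atTop (𝓝 0))
    (hnp : Tendsto (fun n : ℕ => (n : ℝ) * p n) atTop atTop)
    (hb : Tendsto (fun n : ℕ => 2 * Real.log n / (-Real.log (p n))) atTop atTop) :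
    Tendsto (fun n : ℕ => P n {ω | (longestModAP n (fun i => ξ n i ω) : ℤ) ∈
      ({⌊2 * Real.log n / (-Real.log (p n))⌋ - 1, ⌊2 * Real.log n / (-Real.log (p n))⌋,
        ⌊2 * Real.log n / (-Real.log (p n))⌋ + 1} : Set ℤ)}) atTop (𝓝 1) := by
  have hL := tendsto_neg_log_atTop hp_zero hnp
  have hp := eventually_pos_of_tendsto_mul_atTop hnp
  set x : ℕ → ℝ := fun n => 2 * Real.log n / (-Real.log (p n)) with hx
  set m : ℕ → ℕ := fun n => (⌊x n⌋ - 1).toNat with hmdef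
  have hLx : ∀ᶠ n : ℕ in atTop, -Real.log (p n) * x n = 2 * Real.log n := by
    filter_upwards [hL.eventually_gt_atTop 0] with n h
    exact mul_div_cancel₀ _ h.ne'
  have hfloor : ∀ᶠ n in atTop, 2 ≤ m n ∧ (m n : ℤ) = ⌊x n⌋ - 1 := by
    filter_upwards [hb.eventually_ge_atTop 3] with n h
    have : (3 : ℤ) ≤ ⌊x n⌋ := Int.le_floor.2 (by exact_mod_cast h)
    simp only [hmdef]
    omega
  have hmle : ∀ᶠ n in atTop, (m n : ℝ) + 1 ≤ x n ∧ x n < m n + 2 := by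
    filter_upwards [hfloor] with n h
    have : (m n : ℝ) = ⌊x n⌋ - 1 := by exact_mod_cast h.2
    rw [this]
    constructor <;> linarith [Int.floor_le (x n), Int.lt_floor_add_one (x n)]
  have hmL : ∀ᶠ n : ℕ in atTop, -Real.log (p n) * m n ≤ 2 * Real.log n := by
    filter_upwards [hmle, hLx, hL.eventually_gt_atTop 0] with n h1 h2 h4
    nlinarith
  have hexp : Tendsto (fun n => Real.exp (-(-Real.log (p n)))) atTop (𝓝 0) :=
    Real.tendsto_exp_neg_atTop_nhds_zero.comp hL
  refine tendsto_measure_window (X := fun n ω => longestModAP n fun i => ξ n i ω) (m := m)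
    (M := fun n => m n + 3) ?_ ?_ ?_
  · have hlim := (tendsto_overlap_zero hnp hb hL hmL).add (hexp.const_mul 20)
    rw [mul_zero, add_zero] at hlim
    refine squeeze_zero' (.of_forall fun n => measureReal_nonneg) ?_ hlim
    filter_upwards [hp, hp_zero.eventually_le_const (show (0 : ℝ) < 1 / 2 by norm_num), hfloor,
      eventually_pow_le_of_mul_le hL hmL, hmle, hLx, hL.eventually_gt_atTop 0,
      eventually_gt_atTop 0] with n h1 h2 h3 h4 h5 h6 h8 h9
    have : NeZero n := ⟨h9.ne'⟩
    refine (real_longestModAP_lt_le (hB n) h1 h2 h3.1 h4).trans (add_le_add_right ?_ _)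
    rw [sq_mul_pow_eq_exp h9 h1, div_eq_mul_inv, ← Real.exp_neg]
    gcongr
    nlinarith
  · refine squeeze_zero' (.of_forall fun n => measureReal_nonneg) ?_ hexp
    filter_upwards [hp, hmle, hLx, hL.eventually_gt_atTop 0, eventually_gt_atTop 0]
      with n h1 h5 h6 h8 h9
    have : NeZero n := ⟨h9.ne'⟩
    refine (real_le_longestModAP_le (hB n) h1.le (by omega)).trans ?_
    rw [sq_mul_pow_eq_exp h9 h1]
    apply Real.exp_le_exp.2
    push_cast
    nlinarith
  · filter_upwards [hfloor] with n h ω h1 h2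
    simp only [Set.mem_insert_iff, Set.mem_singleton_iff]
    change _ = ⌊x n⌋ - 1 ∨ _ = ⌊x n⌋ ∨ _ = ⌊x n⌋ + 1
    omega

theorem ThresholdLaw.tendsto_eq_floor {X : ∀ n, Ω n → ℕ} {c : ℕ → ℝ} (h : ThresholdLaw P p X c)
    (hp_zero : Tendsto p atTop (𝓝 0))
    (hnp : Tendsto (fun n : ℕ => (n : ℝ) * p n) atTop atTop) {β : ℝ}
    (hb : Tendsto (fun n : ℕ => 2 * Real.log n / (-Real.log (p n))) atTop (𝓝 β))
    (hβ : β = 2 ∨ (2 < β ∧ ∀ k : ℤ, β ≠ (k : ℝ))) :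
    Tendsto (fun n : ℕ => P n {ω | (X n ω : ℤ) = ⌊β⌋}) atTop (𝓝 1) := by
  have hβ2 : 2 ≤ β := by rcases hβ with rfl | h <;> linarith
  have hfl : (2 : ℤ) ≤ ⌊β⌋ := Int.le_floor.2 (by exact_mod_cast hβ2)
  obtain ⟨k, hk⟩ : ∃ k : ℕ, (k : ℤ) = ⌊β⌋ := ⟨⌊β⌋.toNat, by omega⟩
  have hkβ : (k : ℝ) = ⌊β⌋ := by exact_mod_cast hk
  have h1 : Tendsto (fun n : ℕ => (n : ℝ) ^ 2 * p n ^ k) atTop atTop := by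
    -- For β = 2 the length ⌊β⌋ is critical and the limit of the ratio decides nothing, but n² p² =
    -- (np)² → ∞.
    rcases hβ with rfl | ⟨-, hβ⟩
    · have : k = 2 := by
        have : ⌊(2 : ℝ)⌋ = 2 := by exact_mod_cast Int.floor_intCast (R := ℝ) 2
        omega
      subst this
      simp only [← mul_pow]
      exact (tendsto_pow_atTop two_ne_zero).comp hnp
    · have hlt : (k : ℝ) < β := hkβ ▸ lt_of_le_of_ne (Int.floor_le β) (hβ _).symm
      obtain ⟨c, hc1, hc2⟩ := exists_between hlt
      exact tendsto_sq_mul_pow_atTop hp_zero hnp hc1 (hb.eventually_const_lt hc2)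
  have h2 : Tendsto (fun n : ℕ => (n : ℝ) ^ 2 * p n ^ (k + 1)) atTop (𝓝 0) := by
    have hlt : β < ((k + 1 : ℕ) : ℝ) := by
      push_cast; rw [hkβ]; exact Int.lt_floor_add_one β
    obtain ⟨c, hc1, hc2⟩ := exists_between hlt
    exact tendsto_sq_mul_pow_zero hp_zero hnp hc2 (hb.eventually_lt_const hc1)
  refine tendsto_measure_window (h.tendsto_lt_zero k (by omega) h1)
    (h.tendsto_le_zero (k + 1) (by omega) h2) (.of_forall fun n ω h1 h2 => ?_)
  rw [Set.mem_ofPred_eq]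
  omega

end Growing

theorem theorem1p3
    (Ω : ℕ → Type*) [∀ n, MeasurableSpace (Ω n)]
    (P : ∀ n, Measure (Ω n)) [∀ n, IsProbabilityMeasure (P n)]
    (p : ℕ → ℝ) (hp : ∀ n, p n ∈ Set.Icc (0 : ℝ) 1)
    -- row `n` of the array: `ξ n 1, …, ξ n n` are i.i.d. Bernoulli variables of parameter `p n`
    (ξ : ∀ n, ℕ → Ω n → ℕ)
    (hmeas : ∀ n, ∀ i ∈ Finset.Icc 1 n, Measurable (ξ n i))
    (hindep : ∀ n, iIndepFun (fun (i : Finset.Icc 1 n) => ξ n i) (P n))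
    (hone : ∀ n, ∀ i ∈ Finset.Icc 1 n, P n {ω | ξ n i ω = 1} = ENNReal.ofReal (p n))
    (hzero : ∀ n, ∀ i ∈ Finset.Icc 1 n, P n {ω | ξ n i ω = 0} = ENNReal.ofReal (1 - p n))
    (U W : ∀ n, Ω n → ℕ)
    (hU : ∀ n ω, U n ω = longestAP n (fun i => ξ n i ω))
    (hW : ∀ n ω, W n ω = longestModAP n (fun i => ξ n i ω))
    (hp_zero : Tendsto p atTop (𝓝 0))
    (hnp : Tendsto (fun n : ℕ => (n : ℝ) * p n) atTop atTop)
    (b : EReal)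
    (hb : Tendsto (fun n : ℕ => ((2 * Real.log n / (-Real.log (p n)) : ℝ) : EReal))
      atTop (𝓝 b)) :
    -- (i)
    (b = ⊤ →
      Tendsto (fun n : ℕ => P n {ω | (U n ω : ℤ) ∈
          ({⌊2 * Real.log n / (-Real.log (p n)) + Real.log (Real.log n) / Real.log (p n)⌋,
            ⌊2 * Real.log n / (-Real.log (p n)) + Real.log (Real.log n) / Real.log (p n)⌋ + 1} :
              Set ℤ)}) atTop (𝓝 1) ∧
      Tendsto (fun n : ℕ => P n {ω | (W n ω : ℤ) ∈
          ({⌊2 * Real.log n / (-Real.log (p n))⌋ - 1,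
            ⌊2 * Real.log n / (-Real.log (p n))⌋,
            ⌊2 * Real.log n / (-Real.log (p n))⌋ + 1} : Set ℤ)}) atTop (𝓝 1)) ∧
    -- (ii)
    (∀ β : ℝ, b = (β : EReal) → (β = 2 ∨ (2 < β ∧ ∀ k : ℤ, β ≠ (k : ℝ))) →
      Tendsto (fun n : ℕ => P n {ω | (W n ω : ℤ) = ⌊β⌋}) atTop (𝓝 1) ∧
      Tendsto (fun n : ℕ => P n {ω | (U n ω : ℤ) = ⌊β⌋}) atTop (𝓝 1)) ∧
    -- (iii)
    (∀ k : ℕ, 3 ≤ k → b = ((k : ℝ) : EReal) →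
      (Tendsto (fun n : ℕ => P n {ω | W n ω = k ∨ W n ω = k - 1}) atTop (𝓝 1) ∧
       Tendsto (fun n : ℕ => P n {ω | U n ω = k ∨ U n ω = k - 1}) atTop (𝓝 1)) ∧
      ∀ u : EReal,
        Tendsto (fun n : ℕ => (((n : ℝ) ^ 2 * p n ^ k : ℝ) : EReal)) atTop (𝓝 u) →
        (Tendsto (fun n : ℕ => P n {ω | U n ω = k - 1}) atTop
            (𝓝 (EReal.exp (-(u / ((2 * ((k : ℝ) - 1) : ℝ) : EReal))))) ∧
         Tendsto (fun n : ℕ => P n {ω | U n ω = k}) atTop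
            (𝓝 (1 - EReal.exp (-(u / ((2 * ((k : ℝ) - 1) : ℝ) : EReal)))))) ∧
        (Tendsto (fun n : ℕ => P n {ω | W n ω = k - 1}) atTop
            (𝓝 (EReal.exp (-(u / ((2 : ℝ) : EReal))))) ∧
         Tendsto (fun n : ℕ => P n {ω | W n ω = k}) atTop
            (𝓝 (1 - EReal.exp (-(u / ((2 : ℝ) : EReal))))))) := by
  have hB : ∀ n, IsBernoulliFamily (P n) (Finset.Icc 1 n) (fun i => {ω | ξ n i ω = 1}) (p n) :=
    fun n => isBernoulliFamily_of_iIndepFun (hp n).1 (hmeas n) (hindep n) (hone n)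
  have hp0 : ∀ n, 0 ≤ p n := fun n => (hp n).1
  have hp1 : ∀ n, p n ≤ 1 := fun n => (hp n).2
  obtain rfl : U = fun n ω => longestAP n fun i => ξ n i ω := by
    funext n ω; exact hU n ω
  obtain rfl : W = fun n ω => longestModAP n fun i => ξ n i ω := by
    funext n ω; exact hW n ω
  have lawU := thresholdLaw_longestAP hB hp0 hp1 hp_zero hnp
  have lawW := thresholdLaw_longestModAP hB hp0 hp1 hp_zero hnp
  refine ⟨?_, ?_, ?_⟩
  · rintro rfl
    have hb' := EReal.tendsto_coe_nhds_top_iff.1 hb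
    exact ⟨tendsto_longestAP_window hB hp_zero hnp hb',
      tendsto_longestModAP_window hB hp_zero hnp hb'⟩
  · rintro β rfl hβ
    have hb' := EReal.tendsto_coe.1 hb
    exact ⟨lawW.tendsto_eq_floor hp_zero hnp hb' hβ, lawU.tendsto_eq_floor hp_zero hnp hb' hβ⟩
  · rintro k hk rfl
    have hb' := EReal.tendsto_coe.1 hb
    -- The lengths k - 1 and k + 1 lie strictly on either side of b = k; only length k is critical
    -- and depends on u.
    have h1 : Tendsto (fun n : ℕ => (n : ℝ) ^ 2 * p n ^ (k - 1)) atTop atTop := by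
      have hlt : ((k - 1 : ℕ) : ℝ) < k := by exact_mod_cast (by omega : k - 1 < k)
      obtain ⟨c, hc1, hc2⟩ := exists_between hlt
      exact tendsto_sq_mul_pow_atTop hp_zero hnp hc1 (hb'.eventually_const_lt hc2)
    have h2 : Tendsto (fun n : ℕ => (n : ℝ) ^ 2 * p n ^ (k + 1)) atTop (𝓝 0) := by
      have hlt : (k : ℝ) < ((k + 1 : ℕ) : ℝ) := by exact_mod_cast (by omega : k < k + 1)
      obtain ⟨c, hc1, hc2⟩ := exists_between hlt
      exact tendsto_sq_mul_pow_zero hp_zero hnp hc2 (hb'.eventually_lt_const hc1)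
    refine ⟨⟨?_, ?_⟩, fun u hu => ⟨?_, ?_⟩⟩
    · refine tendsto_measure_window (lawW.tendsto_lt_zero (k - 1) (by omega) h1)
        (lawW.tendsto_le_zero (k + 1) (by omega) h2) (.of_forall fun n ω h1 h2 => ?_)
      simp only [Set.mem_ofPred_eq] at h1 h2 ⊢
      omega
    · refine tendsto_measure_window (lawU.tendsto_lt_zero (k - 1) (by omega) h1)
        (lawU.tendsto_le_zero (k + 1) (by omega) h2) (.of_forall fun n ω h1 h2 => ?_)
      simp only [Set.mem_ofPred_eq] at h1 h2 ⊢
      omega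
    · have hk1 : (3 : ℝ) ≤ k := by exact_mod_cast hk
      exact lawU.tendsto_eq_of_tendsto_ereal hp0 hk h1 h2 (by linarith) rfl hu
    · exact lawW.tendsto_eq_of_tendsto_ereal hp0 hk h1 h2 (by norm_num) rfl hu
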